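/- Fix a number $a$ with $0<a<\tfrac13$. There are positive constants $c_5,\varepsilon_0,M_0$ (depending only on $a$) such that the following holds. Write $r\mathbb D=\{z\in\mathbb C:|z|<r\}$. Let $q\in C^\infty(3\mathbb D)$ be real-valued with $\|q\|_\infty=\sup_{3\mathbb D}|q|<\varepsilon_0$, and let $F:3\mathbb D\to\mathbb R$ be a $C^2$ solution, not identically zero, of $$\Delta F+qF=0\quad\text{in }3\mathbb D .$$ Put $$\beta=\log\frac{\sup_{\frac52\mathbb D}|F|}{\sup_{\frac14\mathbb D}|F|},\qquad \beta^*=\max\{\beta,1\}.$$ Let $\delta>0$ satisfy $\delta<\tfrac1{60}$ and $\delta\beta^*<\tfrac12$, put $\gamma=\delta^{-1/2}$, and let $D_\nu=\{|z-z_\nu|<\delta\}\subset\frac1{60}\mathbb D$, $1\le\nu\le N$, be a finite collection of disks that is $\gamma$-separated, i.e. $|z_\mu-z_\nu|\ge 2\gamma\delta$ for all $\mu\ne\nu$. For $M>0$, call $D_\nu$ a disk of $M$-rapid growth for $F$ if $$M\int_{(1-3a)\delta<|z-z_\nu|<(1-\frac43a)\delta}F^2\;\le\;\int_{(1-\frac32a)\delta<|z-z_\nu|<(1-a)\delta}F^2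 .$$ Then, for every $M>M_0$, the number $\mathcal N(M)$ of disks $D_\nu$ of $M$-rapid growth satisfies $$\mathcal N(M)\le c_5\,\beta^* .$$ -/

import Mathlib

open Set Metric MeasureTheory
open scoped ContDiff

namespace NodalGrowth

/-- The supremum of `|f|` over the set `s` (meaningful for `f` bounded on `s`). -/
noncomputable def supAbs (f : ℂ → ℝ) (s : Set ℂ) : ℝ :=
  sSup ((fun z => |f z|) '' s)

/-- `F` is a (classical, real-valued) solution of `Δ F + q F = 0` in the open disk of radius `3`
centred at the origin of the plane. -/
structure IsSchrodingerSolution (q F : ℂ → ℝ) : Prop where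
  contDiffOn : ContDiffOn ℝ 2 F (ball 0 3)
  equation : ∀ z ∈ ball (0 : ℂ) 3, Laplacian.laplacian F z + q z * F z = 0

/-- The growth exponent
`β = log (sup_{|z| < 5/2} |F| / sup_{|z| < 1/4} |F|)`. -/
noncomputable def growthExponent (F : ℂ → ℝ) : ℝ :=
  Real.log (supAbs F (ball 0 (5 / 2)) / supAbs F (ball 0 (1 / 4)))

/-- `β* = max {β, 1}`. -/
noncomputable def betaStar (F : ℂ → ℝ) : ℝ :=
  max (growthExponent F) 1

/-- The open annulus `{r < |z - w| < R}`. -/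
def annulus (w : ℂ) (r R : ℝ) : Set ℂ :=
  {z | r < dist z w ∧ dist z w < R}

/-- The annulus `A' = {(1 - 3a) δ < |z - w| < (1 - 4a/3) δ}` of the disk `D(w, δ)`. -/
def annulusPrime (a δ : ℝ) (w : ℂ) : Set ℂ :=
  annulus w ((1 - 3 * a) * δ) ((1 - 4 / 3 * a) * δ)

/-- The annulus `A'' = {(1 - 3a/2) δ < |z - w| < (1 - a) δ}` of the disk `D(w, δ)`. -/
def annulusSecond (a δ : ℝ) (w : ℂ) : Set ℂ :=
  annulus w ((1 - 3 / 2 * a) * δ) ((1 - a) * δ)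

/-- The disk `D(w, δ)` is a disk of `M`-rapid growth for `F` (with annulus parameter `a`). -/
def IsRapid (a M : ℝ) (F : ℂ → ℝ) (δ : ℝ) (w : ℂ) : Prop :=
  M * ∫ z in annulusPrime a δ w, F z ^ 2 ≤ ∫ z in annulusSecond a δ w, F z ^ 2

/-- The disks of radius `δ` centred at the points of `S` are `γ`-separated. -/
def IsSeparated (γ δ : ℝ) (S : Finset ℂ) : Prop :=
  ∀ w ∈ S, ∀ w' ∈ S, w ≠ w' → 2 * γ * δ ≤ dist w w'

end NodalGrowth

/-!
The idea is to replace the solution `F` by a holomorphic function. Put `F_z = (F_x - i F_y) / 2`.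
If `b` solves the Riccati equation `∂b/∂z̄ = q / 4 + |b|²`, then `w = F_z + b F` satisfies `∂w/∂z̄
= b w̄`, because `∂F_z/∂z̄ = ΔF / 4 = -q F / 4` and `F` is real. By the similarity principle `w =
e^s h` with `h` holomorphic and `s` the Cauchy transform of `b w̄ / w`; when `q` is small, both
`b` and `s` are small. The outcome, `IsSchrodingerSolution.exists_similarity`, is a holomorphic
`h` with `|F_z - h| ≤ |h| / 20 + |F| / 20`. Exact solutions are never needed: Picard iterates for
`b` and a regularised quotient for `b w̄ / w` keep all functions continuously differentiable, and
`h` is obtained from the approximate factors by compactness.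

Testing `F_z` against a radial bump gives interior estimates: `|h|` on `2𝔻` is at most a constant
times `sup_{5/2 𝔻} |F|` (`norm_le_of_abs_le`), and if `|h| ≤ 2 |h(p)|` on a disk of radius `ρ`
about `p`, then `|h(p)|² ρ⁴` is at most a constant times the integral of `F²` over that disk
(`sq_norm_mul_le_integral_sq`). Let `m = sup_{1/4 𝔻} |F|`, which is positive by unique
continuation (`exists_ne_zero_of_similarity`).

If `|h| ≤ m / 20` on `1/4 𝔻`, then `|F|` lies between `m / 2` and `m` there, and no disk is of
rapid growth. Otherwise the doubling of `h` is controlled by `e^β`, so `h` has `O(β*)` zeros `ζ`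
in `3/4 𝔻` and equals the product of the corresponding linear factors with a nonvanishing function
whose logarithm has derivative `O(β*)` on `1/60 𝔻`. Since `δ β* < 1/2`, the latter factor is
essentially constant on each disk of radius `δ`. A linear factor `z - ζ` varies on the disk about
`w` by a relative amount `δ / |w - ζ|`. As the centres are `2 √δ`-separated, each `ζ` is within
`√δ` of at most one centre, and for the other centres `∑_w δ / |w - ζ| ≤ 6` by comparison with `∫
dA(z) / |z - ζ|`. By Markov's inequality, outside a set of `O(β*)` disks the function `h` varies
by a bounded factor and is nearly constant at a small multiple of the scale `δ`
(`exists_finset_slowly_varying`). In such a disk the oscillation of `F`, of order `δ |h|`, is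
controlled by the mean square of `F` over a small disk inside the inner annulus, so the growth is
not rapid (`not_isRapid_of_slowly_varying`).
-/

namespace NodalGrowth

open Complex ComplexConjugate Filter Topology

/-! ### The Cauchy transform -/

/-- The Wirtinger derivative `∂f/∂z̄ = (f_x + i f_y) / 2`. -/
noncomputable def dbar (f : ℂ → ℂ) (z : ℂ) : ℂ :=
  (fderiv ℝ f z 1 + I * fderiv ℝ f z I) / 2

/-- The Cauchy transform `(1/π) ∫ g(z - ζ) / ζ dA(ζ)`, a right inverse of `dbar`. -/
noncomputable def cauchyTransform (g : ℂ → ℂ) (z : ℂ) : ℂ :=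
  (Real.pi : ℂ)⁻¹ * ∫ ζ, ζ⁻¹ * g (z - ζ)

theorem integrableOn_norm_inv_ball :
    IntegrableOn (fun ζ : ℂ => ‖ζ‖⁻¹) (ball 0 1) := by
  rw [integrableOn_fun_norm_addHaar volume (f := fun y : ℝ => y⁻¹)]
  have : IntegrableOn (fun _ : ℝ => (1 : ℝ)) (Ioo 0 1) := by simp
  refine this.congr_fun ?_ measurableSet_Ioo
  intro y hy
  have : y ≠ 0 := hy.1.ne'
  simp [this]

theorem setIntegral_norm_inv_ball :
    ∫ ζ in ball (0 : ℂ) 1, ‖ζ‖⁻¹ = 2 * Real.pi := by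
  have h := integral_fun_norm_addHaar (E := ℂ)
      volume (fun y : ℝ => (Iio (1 : ℝ)).indicator (fun y => y⁻¹) y)
  have e : (fun x : ℂ => (Iio (1 : ℝ)).indicator (fun y => y⁻¹) ‖x‖)
      = (ball (0 : ℂ) 1).indicator (fun x => ‖x‖⁻¹) := by
    ext x; simp [indicator]
  rw [e, integral_indicator measurableSet_ball] at h
  rw [h]
  have : ∫ y in Ioi (0 : ℝ), y ^ (Module.finrank ℝ ℂ - 1) • (Iio (1 : ℝ)).indicator (fun y => y⁻¹) y
      = 1 := by
    have : ∫ y in Ioi (0 : ℝ), y ^ (Module.finrank ℝ ℂ - 1) • (Iio (1 : ℝ)).indicator (fun y => y⁻¹)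
        y
      = ∫ y in Ioi (0 : ℝ), (Iio (1 : ℝ)).indicator (fun _ => (1 : ℝ)) y := by
      refine setIntegral_congr_fun measurableSet_Ioi ?_
      intro y (hy : 0 < y)
      by_cases h1 : y < 1 <;> simp [h1, hy.ne']
    rw [this, setIntegral_indicator measurableSet_Iio]
    simp [Ioi_inter_Iio]
  rw [this]
  simp [Measure.real]

theorem integrableOn_norm_inv {E : Set ℂ} (hE : MeasurableSet E) (hv : volume E ≠ ⊤) :
    IntegrableOn (fun ζ : ℂ => ‖ζ‖⁻¹) E := by
  have h1 : IntegrableOn (fun ζ : ℂ => ‖ζ‖⁻¹) (E ∩ ball 0 1) :=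
    integrableOn_norm_inv_ball.mono_set inter_subset_right
  have h2 : IntegrableOn (fun ζ : ℂ => ‖ζ‖⁻¹) (E \ ball 0 1) := by
    have : IntegrableOn (fun _ : ℂ => (1 : ℝ)) (E \ ball 0 1) :=
      integrableOn_const (measure_ne_top_of_subset sdiff_subset hv)
    refine this.mono' (by fun_prop) ?_
    refine (ae_restrict_iff' (hE.diff measurableSet_ball)).2 (ae_of_all _ ?_)
    intro x hx
    have : 1 ≤ ‖x‖ := by simpa using hx.2
    rw [norm_inv, norm_norm]
    exact inv_le_one_of_one_le₀ this
  simpa [inter_union_sdiff] using h1.union h2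

/-- The singularity `1 / |ζ|` contributes at most `2π`, from the unit disk; elsewhere the integrand
is at most `1`. -/
theorem setIntegral_norm_inv_le {E : Set ℂ} (hE : MeasurableSet E) (hv : volume E ≠ ⊤) :
    ∫ ζ in E, ‖ζ‖⁻¹ ≤ 2 * Real.pi + volume.real E := by
  have hi := integrableOn_norm_inv hE hv
  rw [← inter_union_sdiff E (ball 0 1), setIntegral_union disjoint_sdiff_inter.symm
    (hE.diff measurableSet_ball) (hi.mono_set inter_subset_left) (hi.mono_set sdiff_subset)]
  rw [inter_union_sdiff]
  gcongr
  · rw [← setIntegral_norm_inv_ball]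
    refine setIntegral_mono_set integrableOn_norm_inv_ball (ae_of_all _ fun x => by positivity)
      (ae_of_all _ inter_subset_right)
  · have h1 : ∫ ζ in E \ ball 0 1, ‖ζ‖⁻¹ ≤ ∫ ζ in E \ ball (0 : ℂ) 1, (1 : ℝ) := by
      refine setIntegral_mono_on (hi.mono_set sdiff_subset)
        (integrableOn_const (measure_ne_top_of_subset sdiff_subset hv)) (hE.diff measurableSet_ball)
            ?_
      intro x hx
      have : 1 ≤ ‖x‖ := by simpa using hx.2
      exact inv_le_one_of_one_le₀ this
    refine h1.trans ?_
    simp only [integral_const, smul_eq_mul, mul_one, measureReal_restrict_apply_univ]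
    exact measureReal_mono sdiff_subset hv

theorem locallyIntegrable_inv : LocallyIntegrable (fun ζ : ℂ => ζ⁻¹) := by
  rw [locallyIntegrable_iff]
  intro k hk
  refine (integrableOn_norm_inv hk.measurableSet hk.measure_lt_top.ne).mono' (by fun_prop) ?_
  exact ae_of_all _ fun x => by simp

/-- The constant comes from `∫_{|ζ - z| < 3} dA(ζ) / |ζ| ≤ 2π + 9π`. -/
theorem norm_cauchyTransform_le {g : ℂ → ℂ} {κ : ℝ} (hκ : 0 ≤ κ) (hg : ∀ z, ‖g z‖ ≤ κ)
    (hs : ∀ z, z ∉ ball (0 : ℂ) 3 → g z = 0) (z : ℂ) : ‖cauchyTransform g z‖ ≤ 11 * κ := by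
  have hE : MeasurableSet (ball z 3) := measurableSet_ball
  have hv : volume (ball z 3) ≠ ⊤ := measure_ball_lt_top.ne
  have h0 : ‖∫ ζ, ζ⁻¹ * g (z - ζ)‖ ≤ ∫ ζ, (ball z 3).indicator (fun ζ => κ * ‖ζ‖⁻¹) ζ := by
    refine norm_integral_le_of_norm_le
      ((integrable_indicator_iff hE).2 ((integrableOn_norm_inv hE hv).const_mul κ)) (ae_of_all _ ?_)
    intro ζ
    by_cases h : ζ ∈ ball z 3
    · rw [indicator_of_mem h, norm_mul, norm_inv, mul_comm]
      gcongr
      exact hg _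
    · rw [hs (z - ζ)]
      · simp [indicator_of_notMem h]
      · simpa [dist_eq_norm, norm_sub_rev] using h
  rw [integral_indicator hE, integral_const_mul] at h0
  have h1 := setIntegral_norm_inv_le hE hv
  have h2 : volume.real (ball z 3) = 9 * Real.pi := by
    simp [Measure.real]; ring_nf
  rw [cauchyTransform, norm_mul, norm_inv]
  simp only [norm_real, Real.norm_eq_abs, abs_of_pos Real.pi_pos]
  rw [inv_mul_le_iff₀ Real.pi_pos]
  calc _ ≤ _ := h0
    _ ≤ κ * (2 * Real.pi + 9 * Real.pi) := by rw [h2] at h1; gcongr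
    _ = _ := by ring

theorem cauchyTransform_eq_convolution (g : ℂ → ℂ) :
    cauchyTransform g = fun z => (Real.pi : ℂ)⁻¹ *
      (convolution (fun ζ : ℂ => ζ⁻¹) g (ContinuousLinearMap.mul ℝ ℂ) volume) z := by
  ext z; simp [cauchyTransform, convolution]

theorem contDiff_cauchyTransform {g : ℂ → ℂ} (hg : ContDiff ℝ 1 g) (hc : HasCompactSupport g) :
    ContDiff ℝ 1 (cauchyTransform g) := by
  rw [cauchyTransform_eq_convolution]
  exact contDiff_const.mul (hc.contDiff_convolution_right (n := 1) _ locallyIntegrable_inv hg)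

theorem integrable_inv_mul {g : ℂ → ℂ} (hg : Continuous g) (hc : HasCompactSupport g) (z : ℂ) :
    Integrable (fun ζ => ζ⁻¹ * g (z - ζ)) :=
  hc.convolutionExists_right (ContinuousLinearMap.mul ℝ ℂ) locallyIntegrable_inv hg z

theorem dbar_cauchyTransform {g : ℂ → ℂ} (hg : ContDiff ℝ 1 g) (hc : HasCompactSupport g) (z : ℂ) :
    dbar (cauchyTransform g) z = cauchyTransform (dbar g) z := by
  have h := (hc.hasFDerivAt_convolution_right (ContinuousLinearMap.mul ℝ ℂ)
    locallyIntegrable_inv hg z).const_mul ((Real.pi : ℂ)⁻¹)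
  have hg' : Continuous (fderiv ℝ g) := hg.continuous_fderiv one_ne_zero
  have hc' : HasCompactSupport (fderiv ℝ g) := hc.fderiv ℝ
  have hint := hc'.convolutionExists_right ((ContinuousLinearMap.mul ℝ ℂ).precompR ℂ)
      locallyIntegrable_inv hg' z
  have happ : ∀ v, (convolution (fun ζ : ℂ => ζ⁻¹) (fderiv ℝ g)
      ((ContinuousLinearMap.mul ℝ ℂ).precompR ℂ) volume z) v
      = ∫ ζ, ζ⁻¹ * fderiv ℝ g (z - ζ) v := by
    intro v
    rw [convolution, ContinuousLinearMap.integral_apply hint]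
    rfl
  have hiv : ∀ v, Integrable fun ζ => ζ⁻¹ * fderiv ℝ g (z - ζ) v := by
    intro v
    refine integrable_inv_mul (g := fun x => fderiv ℝ g x v) (by fun_prop) ?_ z
    exact hc'.comp_left (g := fun L : ℂ →L[ℝ] ℂ => L v) (by simp)
  rw [← cauchyTransform_eq_convolution] at h
  rw [dbar, h.fderiv, cauchyTransform]
  simp only [smul_apply, happ, smul_eq_mul]
  have : ∀ ζ, ζ⁻¹ * dbar g (z - ζ) = (1/2) * (ζ⁻¹ * fderiv ℝ g (z - ζ) 1) + (I/2)
      * (ζ⁻¹ * fderiv ℝ g (z - ζ) I) := by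
    intro ζ; rw [dbar]; ring
  simp_rw [this]
  rw [integral_add ((hiv 1).const_mul _) ((hiv I).const_mul _), integral_const_mul,
      integral_const_mul]
  ring

/-- The Cauchy–Pompeiu formula at the origin for a compactly supported function. In polar
coordinates the integrand times the Jacobian `r` is half of `∂_r f + (i / r) ∂_θ f`; the radial
part integrates to `-f 0` along every ray and the angular part to zero along every circle. -/
theorem integral_inv_mul_dbar {f : ℂ → ℂ} (hf : ContDiff ℝ 1 f) (hc : HasCompactSupport f) :
    ∫ ζ, ζ⁻¹ * dbar f ζ = -(Real.pi : ℂ) * f 0 := by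
  set e : ℝ → ℂ := fun θ => Real.cos θ + Real.sin θ * I with he
  have hec : Continuous e := by fun_prop
  have hee : ∀ θ, ‖e θ‖ = 1 := by
    intro θ
    rw [he]
    simp only [ofReal_cos, ofReal_sin, ← exp_mul_I]
    exact norm_exp_ofReal_mul_I θ
  have he0 : ∀ θ, e θ ≠ 0 := fun θ h => by simpa [h] using hee θ
  have hde : ∀ θ, HasDerivAt e (I * e θ) θ := by
    intro θ
    have h1 := (Real.hasDerivAt_cos θ).ofReal_comp
    have h2 := ((Real.hasDerivAt_sin θ).ofReal_comp).mul_const I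
    refine (h1.add h2).congr_deriv ?_
    simp only [he]
    push_cast
    linear_combination -(Complex.sin θ) * I_mul_I
  have hg' : Continuous (fderiv ℝ f) := hf.continuous_fderiv one_ne_zero
  have hc' : HasCompactSupport (fderiv ℝ f) := hc.fderiv ℝ
  obtain ⟨R, hR0, hR⟩ : ∃ R, 0 < R ∧ ∀ z, R ≤ ‖z‖ → fderiv ℝ f z = 0 ∧ f z = 0 := by
    obtain ⟨R, hR⟩ := (hc'.isCompact.isBounded.union hc.isCompact.isBounded).subset_closedBall 0
    refine ⟨max R 0 + 1, by positivity, fun z hz => ⟨?_, ?_⟩⟩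
    · refine image_eq_zero_of_notMem_tsupport fun h => ?_
      have := hR (Or.inl h)
      simp at this
      have := le_max_left R 0
      linarith
    · refine image_eq_zero_of_notMem_tsupport fun h => ?_
      have := hR (Or.inr h)
      simp at this
      have := le_max_left R 0
      linarith
  -- `P` is `∂_r` and `Q` is `(1/r) ∂_θ` of `f (r e^{iθ})`.
  set P : ℝ → ℝ → ℂ := fun r θ => fderiv ℝ f (r * e θ) (e θ) with hP
  set Q : ℝ → ℝ → ℂ := fun r θ => fderiv ℝ f (r * e θ) (I * e θ) with hQ
  have hPc : Continuous (Function.uncurry P) := by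
    simp only [hP, Function.uncurry_def]; fun_prop
  have hQc : Continuous (Function.uncurry Q) := by
    simp only [hQ, Function.uncurry_def]; fun_prop
  have hnorm : ∀ r θ : ℝ, ‖((r : ℂ) * e θ)‖ = |r| := by
    intro r θ; simp [hee]
  have hI : ∀ W : ℝ × ℝ → ℂ, Continuous W → (∀ r θ, R ≤ r → W (r, θ) = 0) →
      IntegrableOn W (Ioi 0 ×ˢ Ioo (-Real.pi) Real.pi) (volume.prod volume) := by
    intro W hW hz
    have : IntegrableOn W (Icc 0 R ×ˢ Icc (-Real.pi) Real.pi) (volume.prod volume) :=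
      hW.continuousOn.integrableOn_compact (isCompact_Icc.prod isCompact_Icc)
    refine this.of_forall_sdiff_eq_zero (by measurability) ?_
    rintro ⟨r, θ⟩ ⟨⟨hr, hθ⟩, h2⟩
    refine hz r θ ?_
    by_contra h
    exact h2 ⟨⟨le_of_lt hr, by simpa using (not_le.1 h).le⟩, hθ.1.le, hθ.2.le⟩
  have hIP := hI _ hPc (by
    intro r θ hr
    have h := (hR (r * e θ) (by rw [hnorm]; exact hr.trans (le_abs_self r))).1
    simp [hP, h])
  have hIQ := hI _ hQc (by
    intro r θ hr
    have h := (hR (r * e θ) (by rw [hnorm]; exact hr.trans (le_abs_self r))).1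
    simp [hQ, h])
  have hdf : ∀ z, HasFDerivAt f (fderiv ℝ f z) z := fun z =>
    (hf.differentiable one_ne_zero z).hasFDerivAt
  have hPint : ∀ θ, ∫ r in Ioi (0 : ℝ), P r θ = - f 0 := by
    intro θ
    have hd : ∀ r : ℝ, HasDerivAt (fun r : ℝ => f (r * e θ)) (P r θ) r := by
      intro r
      have h1 : HasDerivAt (fun r : ℝ => (r : ℂ) * e θ) (e θ) r := by
        simpa using (HasDerivAt.ofReal_comp (hasDerivAt_id r)).mul_const (e θ)
      exact (hdf _).comp_hasDerivAt r h1
    have h2 := integral_Ioi_of_hasDerivAt_of_tendsto (a := 0) (m := 0)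
        (f := fun r : ℝ => f (r * e θ)) (f' := fun r => P r θ)
      (hd 0).continuousAt.continuousWithinAt (fun r _ => hd r) ?_ ?_
    · simpa using h2
    · have : IntegrableOn (fun r => P r θ) (Icc 0 R) := by
        refine Continuous.integrableOn_Icc ?_
        exact hPc.comp (Continuous.prodMk_left θ)
      refine this.of_forall_sdiff_eq_zero measurableSet_Ioi ?_
      rintro r ⟨hr, h2⟩
      have : R ≤ r := by
        by_contra h
        exact h2 ⟨le_of_lt hr, (not_le.1 h).le⟩
      have h := (hR (r * e θ) (by rw [hnorm]; exact this.trans (le_abs_self r))).1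
      simp [hP, h]
    · refine tendsto_const_nhds.congr' ?_
      filter_upwards [Filter.eventually_ge_atTop R] with r hr
      exact ((hR (r * e θ) (by rw [hnorm]; exact hr.trans (le_abs_self r))).2).symm
  have hQint : ∀ r ∈ Ioi (0 : ℝ), ∫ θ in Ioo (-Real.pi) Real.pi, Q r θ = 0 := by
    intro r hr
    have hr0 : (r : ℂ) ≠ 0 := by exact_mod_cast (ne_of_gt hr)
    have hd : ∀ θ : ℝ, HasDerivAt (fun θ : ℝ => (r : ℂ)⁻¹ * f (r * e θ)) (Q r θ) θ := by
      intro θ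
      have h1 : HasDerivAt (fun θ : ℝ => (r : ℂ) * e θ) (r • (I * e θ)) θ := by
        simpa using (hde θ).const_mul (r : ℂ)
      have h2 := ((hdf _).comp_hasDerivAt θ h1).const_mul ((r : ℂ)⁻¹)
      refine h2.congr_deriv ?_
      rw [map_smul, real_smul, ← mul_assoc, inv_mul_cancel₀ hr0, one_mul]
    rw [← integral_Ioc_eq_integral_Ioo, ← intervalIntegral.integral_of_le
        (by linarith [Real.pi_pos]),
      intervalIntegral.integral_eq_sub_of_hasDerivAt (fun θ _ => hd θ)]
    · simp [he]
    · exact (hQc.comp (Continuous.prodMk_right r)).intervalIntegrable _ _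
  rw [← Complex.integral_comp_polarCoord_symm, polarCoord_target]
  have hcongr : ∫ p in Ioi (0 : ℝ) ×ˢ Ioo (-Real.pi) Real.pi,
      p.1 • ((Complex.polarCoord.symm p)⁻¹ * dbar f (Complex.polarCoord.symm p))
      = ∫ p in Ioi (0 : ℝ) ×ˢ Ioo (-Real.pi) Real.pi, ((1/2) * P p.1 p.2 + (I/2) * Q p.1 p.2) := by
    refine setIntegral_congr_fun (by measurability) ?_
    rintro ⟨r, θ⟩ ⟨hr, -⟩
    have hr0 : (r : ℂ) ≠ 0 := by exact_mod_cast (ne_of_gt hr)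
    have hs : Complex.polarCoord.symm (r, θ) = r * e θ := by simp [he]
    simp only [hs, hP, hQ, dbar, real_smul]
    generalize fderiv ℝ f (↑r * e θ) = D
    have hLe : ∀ x y : ℝ, D (x + y * I) = x * D 1 + y * D I := by
      intro x y
      have : (x + y * I : ℂ) = x • (1 : ℂ) + y • I := by simp
      rw [this, map_add, map_smul, map_smul]; simp
    have h1 : D (e θ) = Real.cos θ * D 1 + Real.sin θ * D I := hLe _ _
    have h2 : D (I * e θ) = -Real.sin θ * D 1 + Real.cos θ * D I := by
      have : I * e θ = ((-Real.sin θ : ℝ) : ℂ) + (Real.cos θ : ℝ) * I := by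
        simp only [he]; push_cast; linear_combination (Complex.sin θ) * I_mul_I
      rw [this, hLe]; push_cast; ring
    have hei : (e θ)⁻¹ = Real.cos θ - Real.sin θ * I := by
      refine inv_eq_of_mul_eq_one_right ?_
      simp only [he]
      have := Complex.sin_sq_add_cos_sq (θ : ℂ)
      push_cast
      linear_combination this - (Complex.sin θ)^2 * I_sq
    rw [h1, h2, mul_inv, hei]
    field_simp
    linear_combination -(Real.sin θ * D I) * I_sq
  rw [hcongr, ← Measure.volume_eq_prod] at *
  have hIP' : IntegrableOn (fun p : ℝ × ℝ => P p.1 p.2) (Ioi 0 ×ˢ Ioo (-Real.pi) Real.pi) := hIP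
  have hIQ' : IntegrableOn (fun p : ℝ × ℝ => Q p.1 p.2) (Ioi 0 ×ˢ Ioo (-Real.pi) Real.pi) := hIQ
  rw [integral_add (hIP'.const_mul (1/2)) (hIQ'.const_mul (I/2)), integral_const_mul,
      integral_const_mul]
  have e1 : ∫ p in Ioi (0 : ℝ) ×ˢ Ioo (-Real.pi) Real.pi, P p.1 p.2 = -(2 * Real.pi) * f 0 := by
    rw [Measure.volume_eq_prod, ← setIntegral_prod_swap, setIntegral_prod]
    · simp only [Prod.fst_swap, Prod.snd_swap, hPint]
      simp only [integral_neg, integral_const, measureReal_restrict_apply_univ,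
          Real.volume_real_Ioo]
      rw [max_eq_left (by linarith [Real.pi_pos])]
      simp only [real_smul]; push_cast; ring
    · exact hIP.swap
  have e2 : ∫ p in Ioi (0 : ℝ) ×ˢ Ioo (-Real.pi) Real.pi, Q p.1 p.2 = 0 := by
    rw [Measure.volume_eq_prod, setIntegral_prod (fun p : ℝ × ℝ => Q p.1 p.2) hIQ']
    rw [setIntegral_congr_fun measurableSet_Ioi hQint]
    simp
  rw [e1, e2]; ring

/-- The Cauchy–Pompeiu formula for compactly supported functions. -/
theorem cauchyTransform_dbar {f : ℂ → ℂ} (hf : ContDiff ℝ 1 f) (hc : HasCompactSupport f) (z : ℂ) :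
    cauchyTransform (dbar f) z = f z := by
  have h1 : ContDiff ℝ 1 fun ζ => f (z - ζ) := hf.comp (by fun_prop)
  have h2 : HasCompactSupport fun ζ => f (z - ζ) :=
    hc.comp_homeomorph (Homeomorph.subLeft z)
  have h := integral_inv_mul_dbar h1 h2
  have h3 : ∀ ζ, dbar (fun ζ => f (z - ζ)) ζ = - dbar f (z - ζ) := by
    intro ζ
    have : fderiv ℝ (fun ζ => f (z - ζ)) ζ = - fderiv ℝ f (z - ζ) := by
      have := (hf.differentiable one_ne_zero (z - ζ)).hasFDerivAt.comp ζ
          ((hasFDerivAt_id ζ).const_sub z)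
      have e := this.fderiv
      ext v
      simpa [Function.comp_def] using congrArg (fun L => L v) e
    simp [dbar, this]; ring
  simp only [h3, mul_neg, integral_neg, sub_zero] at h
  have hpi : (Real.pi : ℂ) ≠ 0 := by exact_mod_cast Real.pi_ne_zero
  rw [cauchyTransform]
  rw [show ∫ ζ, ζ⁻¹ * dbar f (z - ζ) = Real.pi * f z by linear_combination -h]
  field_simp

/-! ### The Wirtinger derivative and approximately holomorphic functions -/

theorem dbar_mul {f g : ℂ → ℂ} {z : ℂ} (hf : DifferentiableAt ℝ f z) (hg : DifferentiableAt ℝ g z) :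
    dbar (fun z => f z * g z) z = f z * dbar g z + dbar f z * g z := by
  have := (hf.hasFDerivAt.mul hg.hasFDerivAt).fderiv
  simp only [dbar]
  rw [show fderiv ℝ (fun z => f z * g z) z = _ from this]
  simp
  ring

theorem dbar_add {f g : ℂ → ℂ} {z : ℂ} (hf : DifferentiableAt ℝ f z) (hg : DifferentiableAt ℝ g z) :
    dbar (fun z => f z + g z) z = dbar f z + dbar g z := by
  have := (hf.hasFDerivAt.add hg.hasFDerivAt).fderiv
  simp only [dbar]
  rw [show fderiv ℝ (fun z => f z + g z) z = _ from this]
  simp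
  ring

theorem dbar_cexp_neg {s : ℂ → ℂ} {z : ℂ} (hs : DifferentiableAt ℝ s z) :
    dbar (fun z => cexp (-s z)) z = - cexp (-s z) * dbar s z := by
  have := (hs.hasFDerivAt.neg.cexp).fderiv
  simp only [dbar]
  rw [show fderiv ℝ (fun z => cexp (-s z)) z = _ from this]
  simp
  ring

theorem dbar_congr {f g : ℂ → ℂ} {z : ℂ} (h : f =ᶠ[nhds z] g) : dbar f z = dbar g z := by
  simp only [dbar, h.fderiv_eq]

theorem differentiableAt_of_dbar_eq_zero {f : ℂ → ℂ} {z : ℂ} (hf : DifferentiableAt ℝ f z)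
    (h : dbar f z = 0) : DifferentiableAt ℂ f z := by
  rw [differentiableAt_complex_iff_differentiableAt_real]
  refine ⟨hf, ?_⟩
  have h1 : fderiv ℝ f z 1 + I * fderiv ℝ f z I = 0 := by
    simpa [dbar] using h
  rw [smul_eq_mul]
  linear_combination -I * h1 + fderiv ℝ f z I * I_sq

theorem dbar_cauchyTransform_eq {g : ℂ → ℂ} (hg : ContDiff ℝ 1 g) (hc : HasCompactSupport g)
    (z : ℂ) : dbar (cauchyTransform g) z = g z := by
  rw [dbar_cauchyTransform hg hc, cauchyTransform_dbar hg hc]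

theorem cauchyTransform_sub {f g : ℂ → ℂ} (hf : Continuous f) (hfc : HasCompactSupport f)
    (hg : Continuous g) (hgc : HasCompactSupport g) (z : ℂ) :
    cauchyTransform f z - cauchyTransform g z = cauchyTransform (fun z => f z - g z) z := by
  simp only [cauchyTransform, mul_sub]
  rw [integral_sub (integrable_inv_mul hf hfc z) (integrable_inv_mul hg hgc z)]
  ring

theorem continuous_dbar {f : ℂ → ℂ} (hf : ContDiff ℝ 1 f) : Continuous (dbar f) := by
  have hg' : Continuous (fderiv ℝ f) := hf.continuous_fderiv one_ne_zero
  unfold dbar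
  fun_prop

theorem tsupport_dbar_subset (f : ℂ → ℂ) : tsupport (dbar f) ⊆ tsupport f := by
  refine closure_minimal (fun z hz => ?_) isClosed_closure
  by_contra h
  have : fderiv ℝ f z = 0 := by
    by_contra h'
    exact h (support_fderiv_subset ℝ h')
  simp [dbar, this] at hz

/-- A smooth cutoff function between concentric disks, with values regarded as complex numbers. -/
theorem exists_cutoff {r R : ℝ} (hr : 0 < r) (hrR : r < R) :
    ∃ χ : ℂ → ℂ, ContDiff ℝ ∞ χ ∧ (∀ z ∈ ball (0 : ℂ) r, χ z = 1) ∧ tsupport χ ⊆ ball 0 R ∧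
      (∀ z, ‖χ z‖ ≤ 1) ∧ HasCompactSupport χ := by
  let φ : ContDiffBump (0 : ℂ) := ⟨r, (r + R) / 2, hr, by linarith⟩
  have hs : tsupport (fun z => ((φ z : ℝ) : ℂ)) ⊆ closedBall 0 ((r + R) / 2) := by
    rw [← φ.tsupport_eq]
    exact tsupport_comp_subset (g := fun x : ℝ => (x : ℂ)) (by simp) _
  refine ⟨fun z => (φ z : ℝ), ?_, ?_, ?_, ?_, ?_⟩
  · exact ofRealCLM.contDiff.comp φ.contDiff
  · intro z hz
    have : φ z = 1 := φ.one_of_mem_closedBall (ball_subset_closedBall hz)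
    simp [this]
  · exact hs.trans (closedBall_subset_ball (by linarith))
  · intro z
    simp only [norm_real, Real.norm_eq_abs, abs_of_nonneg φ.nonneg]
    exact φ.le_one
  · exact (isCompact_closedBall _ _).of_isClosed_subset isClosed_closure hs

/-- Multiplying by a function supported in `U` extends a function that is only differentiable on
`U` to a differentiable function on the whole plane. -/
theorem contDiff_cutoff_mul {χ f : ℂ → ℂ} {U : Set ℂ} (hU : IsOpen U) (hχ : ContDiff ℝ 1 χ)
    (hs : tsupport χ ⊆ U) (hf : ContDiffOn ℝ 1 f U) :
    ContDiff ℝ 1 fun z => χ z * f z := by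
  refine contDiff_iff_contDiffAt.2 fun z => ?_
  by_cases hz : z ∈ tsupport χ
  · exact hχ.contDiffAt.mul (hf.contDiffAt (hU.mem_nhds (hs hz)))
  · refine contDiffAt_const (c := (0 : ℂ)) |>.congr_of_eventuallyEq ?_
    filter_upwards [notMem_tsupport_iff_eventuallyEq.1 hz] with w hw
    simp [hw]

/-- A function whose Wirtinger derivative is small is close to a holomorphic function: after a
cutoff `χ`, subtract the Cauchy transform of `χ ∂f/∂z̄`. What remains is the Cauchy transform of `f
∂χ/∂z̄`, which is holomorphic where `χ = 1`. -/
theorem exists_holomorphic_approx {f : ℂ → ℂ} {r R ε : ℝ} (hr : 0 < r) (hrR : r < R) (hR : R ≤ 3)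
    (hε : 0 ≤ ε) (hf : ContDiffOn ℝ 1 f (ball 0 R)) (hd : ∀ z ∈ ball (0 : ℂ) R, ‖dbar f z‖ ≤ ε) :
    ∃ H : ℂ → ℂ, DifferentiableOn ℂ H (ball 0 r) ∧ ∀ z ∈ ball (0 : ℂ) r, ‖f z - H z‖ ≤ 11 * ε := by
  obtain ⟨χ, hχ, hχ1, hχs, hχn, hχc⟩ := exists_cutoff hr hrR
  have hχ' : ContDiff ℝ 1 χ := hχ.of_le (by norm_num)
  have hdχ : ContDiff ℝ 1 (dbar χ) := by
    have : ContDiff ℝ 1 (fderiv ℝ χ) := (contDiff_infty.1 hχ 2).fderiv_right (by norm_num)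
    unfold dbar
    fun_prop
  have hu : ContDiff ℝ 1 fun z => χ z * f z := contDiff_cutoff_mul isOpen_ball hχ' hχs hf
  have huc : HasCompactSupport fun z => χ z * f z := hχc.mul_right
  have hg : ContDiff ℝ 1 fun z => dbar χ z * f z :=
    contDiff_cutoff_mul isOpen_ball hdχ ((tsupport_dbar_subset χ).trans hχs) hf
  have hdχc : HasCompactSupport (dbar χ) :=
    hχc.isCompact.of_isClosed_subset isClosed_closure (tsupport_dbar_subset χ)
  have hgc : HasCompactSupport fun z => dbar χ z * f z := hdχc.mul_right
  have hsub : ∀ z, dbar (fun z => χ z * f z) z - dbar χ z * f z = χ z * dbar f z := by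
    intro z
    by_cases hz : z ∈ ball (0 : ℂ) R
    · rw [dbar_mul (hχ'.differentiable one_ne_zero z)
        ((hf.contDiffAt (isOpen_ball.mem_nhds hz)).differentiableAt one_ne_zero)]
      ring
    · have h0 : z ∉ tsupport χ := fun h => hz (hχs h)
      have h1 : dbar (fun z => χ z * f z) z = 0 :=
        image_eq_zero_of_notMem_tsupport fun h =>
          h0 (tsupport_mul_subset_left (tsupport_dbar_subset _ h))
      have h2 : dbar χ z = 0 :=
        image_eq_zero_of_notMem_tsupport fun h => h0 (tsupport_dbar_subset _ h)
      rw [h1, h2, image_eq_zero_of_notMem_tsupport h0]; ring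
  refine ⟨cauchyTransform fun z => dbar χ z * f z, ?_, ?_⟩
  · intro z hz
    refine (differentiableAt_of_dbar_eq_zero
      ((contDiff_cauchyTransform hg hgc).differentiable one_ne_zero z) ?_).differentiableWithinAt
    rw [dbar_cauchyTransform_eq hg hgc]
    have : dbar χ z = 0 := by
      rw [dbar_congr (g := fun _ => 1)]
      · simp [dbar]
      · filter_upwards [isOpen_ball.mem_nhds hz] with w hw using hχ1 w hw
    simp [this]
  · intro z hz
    have h1 : f z = cauchyTransform (dbar fun z => χ z * f z) z := by
      rw [cauchyTransform_dbar hu huc, hχ1 z hz, one_mul]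
    have hdu : HasCompactSupport (dbar fun z => χ z * f z) :=
      huc.isCompact.of_isClosed_subset isClosed_closure (tsupport_dbar_subset _)
    rw [h1, cauchyTransform_sub (continuous_dbar hu) hdu hg.continuous hgc]
    simp only [hsub]
    refine norm_cauchyTransform_le hε ?_ ?_ z
    · intro w
      by_cases hw : w ∈ ball (0 : ℂ) R
      · rw [norm_mul]
        calc _ ≤ 1 * ε := mul_le_mul (hχn w) (hd w hw) (norm_nonneg _) zero_le_one
          _ = ε := one_mul ε
      · rw [image_eq_zero_of_notMem_tsupport fun h => hw (hχs h)]; simpa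
    · intro w hw
      rw [image_eq_zero_of_notMem_tsupport fun h => hw (ball_subset_ball hR (hχs h)), zero_mul]

/-! ### The similarity principle -/

/-- The Wirtinger derivative `∂F/∂z = (F_x - i F_y) / 2` of a real-valued function. -/
noncomputable def dz (F : ℂ → ℝ) (z : ℂ) : ℂ :=
  ((fderiv ℝ F z 1 : ℝ) - I * (fderiv ℝ F z I : ℝ)) / 2

theorem contDiffOn_dz {F : ℂ → ℝ} {s : Set ℂ} (hs : IsOpen s) (hF : ContDiffOn ℝ 2 F s) :
    ContDiffOn ℝ 1 (dz F) s := by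
  have h : ContDiffOn ℝ 1 (fderiv ℝ F) s := hF.fderiv_of_isOpen hs (by norm_num)
  have h1 : ∀ v, ContDiffOn ℝ 1 (fun z => ((fderiv ℝ F z v : ℝ) : ℂ)) s := fun v =>
    ofRealCLM.contDiff.comp_contDiffOn (h.clm_apply contDiffOn_const)
  exact ((h1 1).sub (contDiffOn_const.mul (h1 I))).div_const 2

theorem dbar_ofReal {F : ℂ → ℝ} {z : ℂ} (hF : DifferentiableAt ℝ F z) :
    dbar (fun z => (F z : ℂ)) z = conj (dz F z) := by
  have h := ofRealCLM.hasFDerivAt.comp z hF.hasFDerivAt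
  simp only [dbar, dz]
  rw [show fderiv ℝ (fun z => (F z : ℂ)) z = _ from h.fderiv]
  simp only [map_div₀, map_ofNat]
  simp

/-- The factorisation `4 ∂_z̄ ∂_z = Δ`. -/
theorem dbar_dz {F : ℂ → ℝ} {z : ℂ} (hF : ContDiffAt ℝ 2 F z) :
    dbar (dz F) z = ((Laplacian.laplacian F z : ℝ) : ℂ) / 4 := by
  have h1 : DifferentiableAt ℝ (fderiv ℝ F) z :=
    (hF.fderiv_right (m := 1) (by norm_num)).differentiableAt one_ne_zero
  have h2 : ∀ v, HasFDerivAt (fun z => ((fderiv ℝ F z v : ℝ) : ℂ))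
      (ofRealCLM.comp ((ContinuousLinearMap.apply ℝ ℝ v).comp (fderiv ℝ (fderiv ℝ F) z))) z :=
          fun v =>
    ofRealCLM.hasFDerivAt.comp z ((ContinuousLinearMap.apply ℝ ℝ v).hasFDerivAt.comp z
        h1.hasFDerivAt)
  have h3 : HasFDerivAt (dz F) _ z := ((h2 1).sub ((h2 I).const_mul I)).mul_const (2 : ℂ)⁻¹
  have hsymm : fderiv ℝ (fderiv ℝ F) z 1 I = fderiv ℝ (fderiv ℝ F) z I 1 :=
    (hF.isSymmSndFDerivAt (by simp)).eq _ _
  rw [dbar, h3.fderiv, InnerProductSpace.laplacian_eq_iteratedFDeriv_complexPlane]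
  simp only [iteratedFDeriv_two_apply]
  simp [hsymm]
  linear_combination -((fderiv ℝ (fderiv ℝ F) z I I : ℝ) : ℂ) / 4 * I_sq

/-- Picard iterates for the Riccati equation `∂b/∂z̄ = Q + χ |b|²`, solved by means of the Cauchy
transform. They stay in a small ball, on which the iteration is a contraction for the supremum
norm. -/
theorem exists_riccati_iterates {Q χ : ℂ → ℂ} (hQ : ContDiff ℝ 1 Q) (hQc : HasCompactSupport Q)
    (hQ3 : ∀ z, z ∉ ball (0 : ℂ) 3 → Q z = 0) (hQn : ∀ z, ‖Q z‖ ≤ 1 / 40000)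
    (hχ : ContDiff ℝ 1 χ) (hχc : HasCompactSupport χ)
    (hχ3 : ∀ z, z ∉ ball (0 : ℂ) 3 → χ z = 0) (hχn : ∀ z, ‖χ z‖ ≤ 1) :
    ∃ b : ℕ → ℂ → ℂ, ∀ n, ContDiff ℝ 1 (b n) ∧ (∀ z, ‖b n z‖ ≤ 1 / 1000) ∧
      (∀ z, ‖b (n + 1) z - b n z‖ ≤ (1 / 2) ^ n) ∧
      ∀ z, dbar (b (n + 1)) z = Q z + χ z * (b n z * conj (b n z)) := by
  let N : (ℂ → ℂ) → ℂ → ℂ := fun b z => Q z + χ z * (b z * conj (b z))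
  let b : ℕ → ℂ → ℂ := fun n => (fun b => cauchyTransform (N b))^[n] 0
  have hbs : ∀ n, b (n + 1) = cauchyTransform (N (b n)) := fun n =>
    Function.iterate_succ_apply' _ _ _
  have hNd : ∀ b, ContDiff ℝ 1 b → ContDiff ℝ 1 (N b) := fun b hb =>
    hQ.add (hχ.mul (hb.mul (conjCLE.contDiff.comp hb)))
  have hNc : ∀ b, HasCompactSupport (N b) := fun b => hQc.add hχc.mul_right
  have hN3 : ∀ b z, z ∉ ball (0 : ℂ) 3 → N b z = 0 := by
    intro b z hz; simp only [N]; rw [hQ3 z hz, hχ3 z hz]; ring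
  have hd : ∀ n, ContDiff ℝ 1 (b n) := by
    intro n
    induction n with
    | zero => exact contDiff_const (c := (0 : ℂ))
    | succ n ih => rw [hbs]; exact contDiff_cauchyTransform (hNd _ ih) (hNc _)
  have hn : ∀ n z, ‖b n z‖ ≤ 1 / 1000 := by
    intro n
    induction n with
    | zero => intro z; simp [b]
    | succ n ih =>
      intro z
      rw [hbs]
      refine (norm_cauchyTransform_le (κ := 1 / 40000 + 1 * (1 / 1000 * (1 / 1000))) (by norm_num)
        ?_ (hN3 _) z).trans (by norm_num)
      intro w
      refine (norm_add_le _ _).trans (add_le_add (hQn w) ?_)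
      rw [norm_mul, norm_mul, RCLike.norm_conj]
      gcongr
      exacts [hχn w, ih w, ih w]
  refine ⟨b, fun n => ⟨hd n, hn n, ?_, ?_⟩⟩
  · induction n with
    | zero =>
      intro z
      have := hn 1 z
      simp only [b, Function.iterate_zero, id, Pi.zero_apply, sub_zero, pow_zero] at this ⊢
      linarith
    | succ n ih =>
      intro z
      rw [congrFun (hbs (n + 1)) z, congrFun (hbs n) z, cauchyTransform_sub
        (hNd _ (hd _)).continuous (hNc _) (hNd _ (hd _)).continuous (hNc _)]
      have hp : (0 : ℝ) ≤ (1 / 2) ^ n := by positivity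
      refine (norm_cauchyTransform_le (κ := 1 / 500 * (1 / 2) ^ n) (by positivity) ?_ ?_ z).trans ?_
      · intro w
        have e : N (b (n + 1)) w - N (b n) w = χ w * ((b (n + 1) w - b n w) * conj (b (n + 1) w)
            + b n w * conj (b (n + 1) w - b n w)) := by
          simp only [N, map_sub]; ring
        rw [e, norm_mul]
        have h1 : ‖(b (n + 1) w - b n w) * conj (b (n + 1) w)‖ ≤ (1 / 2) ^ n * (1 / 1000) := by
          rw [norm_mul, RCLike.norm_conj]
          gcongr
          exacts [ih w, hn _ w]
        have h2 : ‖b n w * conj (b (n + 1) w - b n w)‖ ≤ 1 / 1000 * (1 / 2) ^ n := by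
          rw [norm_mul, RCLike.norm_conj]
          gcongr
          exacts [hn _ w, ih w]
        refine (mul_le_mul (hχn w) ((norm_add_le _ _).trans (add_le_add h1 h2)) (norm_nonneg _)
          zero_le_one).trans (le_of_eq ?_)
        ring
      · intro w hw
        rw [hN3 _ w hw, hN3 _ w hw, sub_zero]
      · rw [pow_succ]; linarith
  · intro z
    rw [hbs]
    exact dbar_cauchyTransform_eq (hNd _ (hd n)) (hNc _) z

/-- The similarity principle for approximate solutions of `∂w/∂z̄ = b w̄`. The quotient `b w̄ / w`
may be discontinuous at the zeros of `w`; it is replaced by `b w̄² / (|w|² + η²)`, and if `s` is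
the Cauchy transform of this function, then `e^{-s} w` has Wirtinger derivative of size `O(η)`. -/
theorem exists_holomorphic_near {w b : ℂ → ℂ} {r R η : ℝ} (hr : 0 < r) (hrR : r < R) (hR : R ≤ 3)
    (hη : 0 < η) (hw : ContDiffOn ℝ 1 w (ball 0 R)) (hb : ContDiff ℝ 1 b)
    (hbn : ∀ z, ‖b z‖ ≤ 1 / 1000)
    (hd : ∀ z ∈ ball (0 : ℂ) R, ‖dbar w z - b z * conj (w z)‖ ≤ η) :
    ∃ H : ℂ → ℂ, DifferentiableOn ℂ H (ball 0 r) ∧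
      ∀ z ∈ ball (0 : ℂ) r, ‖w z - H z‖ ≤ ‖H z‖ / 20 + 100 * η := by
  obtain ⟨R', hrR', hR'R⟩ := exists_between hrR
  obtain ⟨χ, hχ, hχ1, hχs, hχn, hχc⟩ := exists_cutoff (hr.trans hrR') hR'R
  have hχ' : ContDiff ℝ 1 χ := hχ.of_le (by norm_num)
  set D : ℂ → ℂ := fun z => w z * conj (w z) + (η : ℂ) ^ 2 with hD
  have hDn : ∀ z, D z = ((‖w z‖ ^ 2 + η ^ 2 : ℝ) : ℂ) := by
    intro z; simp only [hD, mul_conj']; push_cast; ring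
  have hDpos : ∀ z, 0 < ‖w z‖ ^ 2 + η ^ 2 := fun z => by positivity
  have hD0 : ∀ z, D z ≠ 0 := by
    intro z; rw [hDn]; exact_mod_cast (hDpos z).ne'
  have hDa : ∀ z, ‖D z‖ = ‖w z‖ ^ 2 + η ^ 2 := by
    intro z; rw [hDn, norm_real, Real.norm_of_nonneg (hDpos z).le]
  set α : ℂ → ℂ := fun z => b z * conj (w z) ^ 2 / D z with hα
  have hcw : ContDiffOn ℝ 1 (fun z => conj (w z)) (ball 0 R) :=
    conjCLE.contDiff.comp_contDiffOn hw
  have hDd : ContDiffOn ℝ 1 D (ball 0 R) := (hw.mul hcw).add contDiffOn_const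
  have hαd : ContDiffOn ℝ 1 α (ball 0 R) := by
    simp only [hα, div_eq_mul_inv]
    exact (hb.contDiffOn.mul (hcw.pow 2)).mul (hDd.inv fun z _ => hD0 z)
  have hαn : ∀ z, ‖α z‖ ≤ 1 / 1000 := by
    intro z
    simp only [hα]
    rw [norm_div, hDa, norm_mul, norm_pow, RCLike.norm_conj, div_le_iff₀ (hDpos z)]
    have := hbn z
    gcongr
    nlinarith [sq_nonneg η]
  have hg : ContDiff ℝ 1 fun z => χ z * α z := contDiff_cutoff_mul isOpen_ball hχ' hχs hαd
  have hgc : HasCompactSupport fun z => χ z * α z := hχc.mul_right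
  set s := cauchyTransform fun z => χ z * α z with hs
  have hsd : ContDiff ℝ 1 s := contDiff_cauchyTransform hg hgc
  have hsn : ∀ z, ‖s z‖ ≤ 11 / 1000 := by
    intro z
    refine (norm_cauchyTransform_le (κ := 1 / 1000) (by norm_num) ?_ ?_ z).trans (by norm_num)
    · intro z
      rw [norm_mul]
      calc _ ≤ 1 * (1 / 1000 : ℝ) := by gcongr; exacts [hχn z, hαn z]
        _ = _ := by norm_num
    · intro z hz
      rw [image_eq_zero_of_notMem_tsupport fun h => hz (ball_subset_ball hR (hχs h)), zero_mul]
  have hexp : ∀ x : ℂ, ‖x‖ ≤ 11 / 1000 → ‖cexp x - 1‖ ≤ 22 / 1000 := by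
    intro x hx
    have := Complex.norm_exp_sub_one_le (x := x) (by linarith)
    linarith
  have hdf : ∀ z ∈ ball (0 : ℂ) R', ‖dbar (fun z => cexp (-s z) * w z) z‖ ≤ 4 * η := by
    intro z hz
    have hzR : z ∈ ball (0 : ℂ) R := ball_subset_ball hR'R.le hz
    have hwz := (hw.contDiffAt (isOpen_ball.mem_nhds hzR)).differentiableAt one_ne_zero
    have hsz := hsd.differentiable one_ne_zero z
    have hsz' : DifferentiableAt ℝ (fun z => cexp (-s z)) z := hsz.neg.cexp
    rw [dbar_mul hsz' hwz, dbar_cexp_neg hsz, dbar_cauchyTransform_eq hg hgc, hχ1 z hz]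
    have e : cexp (-s z) * dbar w z + -cexp (-s z) * (1 * α z) * w z
        = cexp (-s z) * ((dbar w z - b z * conj (w z)) + b z * (conj (w z) * (η : ℂ) ^ 2 / D z)) :=
            by
      have : α z * w z = b z * conj (w z) - b z * (conj (w z) * (η : ℂ) ^ 2 / D z) := by
        have := hD0 z
        simp only [hα]
        field_simp
        simp only [hD]; ring
      linear_combination -cexp (-s z) * this
    rw [e, norm_mul]
    have h1 : ‖cexp (-s z)‖ ≤ 2 := by
      have := hexp (-s z) (by rw [norm_neg]; exact hsn z)
      have h := norm_le_norm_sub_add (cexp (-s z)) 1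
      simp only [norm_one] at h
      linarith
    have h2 : ‖b z * (conj (w z) * (η : ℂ) ^ 2 / D z)‖ ≤ 1 / 1000 * η := by
      rw [norm_mul, norm_div, hDa, norm_mul, RCLike.norm_conj, norm_pow, norm_real,
        Real.norm_of_nonneg hη.le]
      gcongr
      · exact hbn z
      · rw [div_le_iff₀ (hDpos z)]
        nlinarith [sq_nonneg (‖w z‖ - η), sq_nonneg (‖w z‖ + η), norm_nonneg (w z)]
    have h3 := (norm_add_le _ _).trans (add_le_add (hd z hzR) h2)
    calc _ ≤ 2 * (η + 1 / 1000 * η) := by gcongr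
      _ ≤ 4 * η := by linarith
  obtain ⟨H, hH, hHa⟩ := exists_holomorphic_approx hr hrR' (hR'R.le.trans hR) (by positivity)
    ((hsd.neg.cexp.contDiffOn).mul (hw.mono (ball_subset_ball hR'R.le))) hdf
  refine ⟨H, hH, fun z hz => ?_⟩
  have h1 := hHa z hz
  set f := cexp (-s z) * w z with hf
  have hwf : w z = cexp (s z) * f := by
    rw [hf, ← mul_assoc, ← Complex.exp_add]; simp
  have h2 : w z - H z = (cexp (s z) - 1) * f + (f - H z) := by rw [hwf]; ring
  have h3 : ‖f‖ ≤ ‖H z‖ + 11 * (4 * η) := by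
    have := norm_le_norm_sub_add f (H z)
    have h1' : ‖f - H z‖ ≤ 11 * (4 * η) := h1
    linarith
  have h4 := hexp _ (hsn z)
  calc ‖w z - H z‖ ≤ ‖cexp (s z) - 1‖ * ‖f‖ + ‖f - H z‖ := by
        rw [h2, ← norm_mul]; exact norm_add_le _ _
    _ ≤ 22 / 1000 * (‖H z‖ + 11 * (4 * η)) + 11 * (4 * η) := by gcongr
    _ ≤ _ := by linarith [norm_nonneg (H z)]

/-- Montel's theorem on a disk, by compactness of the sequences of Taylor coefficients. -/
theorem exists_subseq_tendsto_holomorphic {H : ℕ → ℂ → ℂ} {r R A : ℝ} (hr : 0 < r) (hrR : r < R)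
    (hH : ∀ k, DifferentiableOn ℂ (H k) (ball 0 R)) (hA : ∀ k, ∀ z ∈ ball (0 : ℂ) R, ‖H k z‖ ≤ A) :
    ∃ (φ : ℕ → ℕ) (h : ℂ → ℂ), StrictMono φ ∧ DifferentiableOn ℂ h (ball 0 r) ∧
      ∀ z ∈ ball (0 : ℂ) r, Tendsto (fun k => H (φ k) z) atTop (𝓝 (h z)) := by
  set c : ℕ → ℕ → ℂ := fun k n => (n.factorial : ℂ)⁻¹ * iteratedDeriv n (H k) 0 with hc
  have hcn : ∀ k n, ‖c k n‖ ≤ A / r ^ n := by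
    intro k n
    have h1 : DiffContOnCl ℂ (H k) (ball 0 r) := by
      refine ((hH k).mono ?_).diffContOnCl
      rw [closure_ball _ hr.ne']
      exact closedBall_subset_ball hrR
    have h2 := norm_iteratedDeriv_le_of_forall_mem_sphere_norm_le n hr h1 (C := A)
      (fun z hz => hA k z (sphere_subset_closedBall.trans (closedBall_subset_ball hrR) hz))
    have hn : (0 : ℝ) < n.factorial := by positivity
    simp only [hc]
    rw [norm_mul, norm_inv, norm_natCast, inv_mul_le_iff₀ hn]
    calc _ ≤ _ := h2
      _ = _ := by ring
  obtain ⟨a, -, φ, hφ, hlim⟩ := (isCompact_univ_pi fun n : ℕ =>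
    isCompact_closedBall (0 : ℂ) (A / r ^ n)).tendsto_subseq (x := c)
    (fun k n _ => by simpa using hcn k n)
  have hlim' : ∀ n, Tendsto (fun k => c (φ k) n) atTop (𝓝 (a n)) := fun n =>
    (tendsto_pi_nhds.1 hlim) n
  have han : ∀ n, ‖a n‖ ≤ A / r ^ n := fun n =>
    le_of_tendsto (hlim' n).norm (Eventually.of_forall fun k => hcn _ n)
  have hsum : ∀ ρ, 0 ≤ ρ → ρ < r → Summable fun n : ℕ => A / r ^ n * ρ ^ n := by
    intro ρ h0 h1
    have := (summable_geometric_of_lt_one (r := ρ / r) (by positivity)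
      ((div_lt_one hr).2 h1)).mul_left A
    refine this.congr fun n => ?_
    rw [div_pow]; ring
  refine ⟨φ, fun z => ∑' n, a n * z ^ n, hφ, ?_, ?_⟩
  · intro z hz
    have hz' : ‖z‖ < r := by simpa using hz
    obtain ⟨ρ, h1, h2⟩ := exists_between hz'
    have h0 : 0 ≤ ρ := (norm_nonneg z).trans h1.le
    have := differentiableOn_tsum_of_summable_norm (F := fun n z => a n * z ^ n) (hsum ρ h0 h2)
      (fun n => by fun_prop) (isOpen_ball (x := (0 : ℂ)) (ε := ρ)) (fun n w hw => by
        rw [norm_mul, norm_pow]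
        have hw' : ‖w‖ ≤ ρ := by simpa using (ball_subset_closedBall hw)
        gcongr
        exact (norm_nonneg _).trans (han n)
        exact han n)
    exact (this.differentiableAt (isOpen_ball.mem_nhds (by simpa using h1))).differentiableWithinAt
  · intro z hz
    have hz' : ‖z‖ < r := by simpa using hz
    have hser : ∀ k, H k z = ∑' n, c k n * z ^ n := by
      intro k
      have := Complex.hasSum_taylorSeries_on_ball (hH k) (ball_subset_ball hrR.le hz)
      rw [← this.tsum_eq]
      refine tsum_congr fun n => ?_
      simp only [hc, sub_zero, smul_eq_mul]
      ring
    simp_rw [hser]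
    refine tendsto_tsum_of_dominated_convergence (hsum ‖z‖ (norm_nonneg z) hz')
      (fun n => (hlim' n).mul_const _) (Eventually.of_forall fun k n => ?_)
    rw [norm_mul, norm_pow]
    gcongr
    exact hcn _ n

/-- With `b` the `(n + 1)`-st Picard iterate, `w = F_z + b F` solves `∂w/∂z̄ = b w̄` up to an error
`(|b_n|² - |b_{n+1}|²) F`. -/
theorem IsSchrodingerSolution.exists_approx_similarity {q F : ℂ → ℝ}
    (hq : ContDiffOn ℝ 1 q (ball 0 3))
    (hqn : ∀ z ∈ ball (0 : ℂ) 3, |q z| ≤ 1 / 10000) (hF : IsSchrodingerSolution q F)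
        {r ε : ℝ} (hr : 0 < r)
    (hr3 : r < 3) (hε : 0 < ε) :
    ∃ H : ℂ → ℂ, DifferentiableOn ℂ H (ball 0 r) ∧
      ∀ z ∈ ball (0 : ℂ) r, ‖dz F z - H z‖ ≤ ‖H z‖ / 20 + |F z| / 20 + ε := by
  obtain ⟨R, hrR, hR3⟩ := exists_between hr3
  have hR0 := hr.trans hrR
  have hRsub : ball (0 : ℂ) R ⊆ ball 0 3 := ball_subset_ball hR3.le
  obtain ⟨χ, hχ, hχ1, hχs, hχn, hχc⟩ := exists_cutoff hR0 hR3
  have hχ' : ContDiff ℝ 1 χ := hχ.of_le (by norm_num)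
  have hχ0 : ∀ z, z ∉ ball (0 : ℂ) 3 → χ z = 0 := fun z hz =>
    image_eq_zero_of_notMem_tsupport fun h => hz (hχs h)
  have hq4 : ContDiffOn ℝ 1 (fun z => ((q z : ℝ) : ℂ) / 4) (ball 0 3) :=
    (ofRealCLM.contDiff.comp_contDiffOn hq).div_const 4
  obtain ⟨b, hb⟩ := exists_riccati_iterates (contDiff_cutoff_mul isOpen_ball hχ' hχs hq4)
      hχc.mul_right
    (fun z hz => by rw [hχ0 z hz, zero_mul]) (fun z => by
      by_cases hz : z ∈ ball (0 : ℂ) 3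
      · rw [norm_mul, norm_div, norm_real, Real.norm_eq_abs]
        have := hqn z hz
        calc _ ≤ 1 * (1 / 10000 / ‖(4 : ℂ)‖) := by
              gcongr
              exact hχn z
          _ = _ := by norm_num
      · rw [hχ0 z hz]; norm_num) hχ' hχc hχ0 hχn
  obtain ⟨A, hA⟩ : ∃ A, ∀ z ∈ ball (0 : ℂ) R, |F z| ≤ A := by
    obtain ⟨A, hA⟩ := (isCompact_closedBall (0 : ℂ) R).exists_bound_of_continuousOn
      (hF.contDiffOn.continuousOn.mono (closedBall_subset_ball hR3))
    exact ⟨A, fun z hz => hA z (ball_subset_closedBall hz)⟩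
  have hA0 : 0 ≤ A := (abs_nonneg _).trans (hA 0 (by simpa using hR0))
  obtain ⟨n, hn⟩ := exists_pow_lt_of_lt_one (show 0 < ε / 100 / (A + 1) by positivity)
    (show (1 / 2 : ℝ) < 1 by norm_num)
  obtain ⟨-, hbn, hbd, hbe⟩ := hb n
  obtain ⟨hb1, hbn1, -, -⟩ := hb (n + 1)
  set w : ℂ → ℂ := fun z => dz F z + b (n + 1) z * (F z : ℂ) with hw
  have hFc : ContDiffOn ℝ 2 (fun z => (F z : ℂ)) (ball 0 3) :=
    ofRealCLM.contDiff.comp_contDiffOn hF.contDiffOn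
  have hdzF := contDiffOn_dz isOpen_ball hF.contDiffOn
  have hwd : ContDiffOn ℝ 1 w (ball 0 R) :=
    (hdzF.add (hb1.contDiffOn.mul (hFc.of_le (by norm_num)))).mono hRsub
  have hdw : ∀ z ∈ ball (0 : ℂ) R, ‖dbar w z - b (n + 1) z * conj (w z)‖ ≤ ε / 100 := by
    intro z hz
    have hz3 := isOpen_ball.mem_nhds (hRsub hz)
    have hFz := hF.contDiffOn.contDiffAt hz3
    have hFd := hFz.differentiableAt two_ne_zero
    have hFcd := (hFc.contDiffAt hz3).differentiableAt two_ne_zero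
    have hbd1 := hb1.differentiable one_ne_zero z
    have e : dbar w z = dbar (dz F) z + (b (n + 1) z * conj (dz F z) + dbar (b (n + 1)) z * F z) :=
        by
      rw [← dbar_ofReal hFd, ← dbar_mul hbd1 hFcd]
      exact dbar_add ((hdzF.contDiffAt hz3).differentiableAt one_ne_zero) (hbd1.mul hFcd)
    have hL : Laplacian.laplacian F z = -(q z * F z) := by
      linarith [hF.equation z (hRsub hz)]
    have e2 : dbar w z - b (n + 1) z * conj (w z) =
        -((b (n + 1) z - b n z) * conj (b n z) + b (n + 1) z * conj (b (n + 1) z - b n z)) * F z :=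
            by
      rw [e, dbar_dz hFz, hbe, hχ1 z hz, hL]
      simp only [hw, map_add, map_sub, map_mul, conj_ofReal]
      push_cast
      ring
    rw [e2, norm_mul, norm_neg, norm_real, Real.norm_eq_abs]
    have h1 : ‖(b (n + 1) z - b n z) * conj (b n z)‖ ≤ (1 / 2) ^ n * (1 / 1000) := by
      rw [norm_mul, RCLike.norm_conj]
      gcongr
      exacts [hbd z, hbn z]
    have h2 : ‖b (n + 1) z * conj (b (n + 1) z - b n z)‖ ≤ 1 / 1000 * (1 / 2) ^ n := by
      rw [norm_mul, RCLike.norm_conj]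
      gcongr
      exacts [hbn1 z, hbd z]
    have h3 := (norm_add_le _ _).trans (add_le_add h1 h2)
    have h4 : (1 / 2 : ℝ) ^ n * (A + 1) ≤ ε / 100 := by
      rw [lt_div_iff₀ (by positivity)] at hn
      exact hn.le
    have hp : (0 : ℝ) ≤ (1 / 2) ^ n := by positivity
    calc _ ≤ ((1 / 2) ^ n * (1 / 1000) + 1 / 1000 * (1 / 2) ^ n) * A := by
          gcongr
          exact hA z hz
      _ ≤ (1 / 2 : ℝ) ^ n * (A + 1) := by nlinarith
      _ ≤ _ := h4
  obtain ⟨H, hH, hHw⟩ := exists_holomorphic_near hr hrR hR3.le (by positivity) hwd hb1 hbn1 hdw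
  refine ⟨H, hH, fun z hz => ?_⟩
  have h1 := hHw z hz
  have h2 : dz F z - H z = (w z - H z) - b (n + 1) z * F z := by simp only [hw]; ring
  have h3 : ‖b (n + 1) z * (F z : ℂ)‖ ≤ 1 / 1000 * |F z| := by
    rw [norm_mul, norm_real, Real.norm_eq_abs]
    gcongr
    exact hbn1 z
  rw [h2]
  refine (norm_sub_le _ _).trans ?_
  linarith [abs_nonneg (F z)]

/-- The complex gradient of a solution is pointwise comparable to a holomorphic function, up to a
small multiple of the solution itself. -/
theorem IsSchrodingerSolution.exists_similarity {q F : ℂ → ℝ} (hq : ContDiffOn ℝ 1 q (ball 0 3))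
    (hqn : ∀ z ∈ ball (0 : ℂ) 3, |q z| ≤ 1 / 10000) (hF : IsSchrodingerSolution q F)
        {r : ℝ} (hr : 0 < r)
    (hr3 : r < 3) :
    ∃ h : ℂ → ℂ, DifferentiableOn ℂ h (ball 0 r) ∧
      ∀ z ∈ ball (0 : ℂ) r, ‖dz F z - h z‖ ≤ ‖h z‖ / 20 + |F z| / 20 := by
  obtain ⟨R, hrR, hR3⟩ := exists_between hr3
  have hR0 := hr.trans hrR
  have hsub : closedBall (0 : ℂ) R ⊆ ball 0 3 := closedBall_subset_ball hR3
  have hdzF := contDiffOn_dz isOpen_ball hF.contDiffOn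
  obtain ⟨A, hA⟩ := (isCompact_closedBall (0 : ℂ) R).exists_bound_of_continuousOn
      (hF.contDiffOn.continuousOn.mono hsub)
  obtain ⟨B, hB⟩ := (isCompact_closedBall (0 : ℂ) R).exists_bound_of_continuousOn
      (hdzF.continuousOn.mono hsub)
  choose H hH hHn using fun k : ℕ => hF.exists_approx_similarity hq hqn hR0 hR3
    (show (0 : ℝ) < 1 / (k + 1) by positivity)
  have hbound : ∀ k, ∀ z ∈ ball (0 : ℂ) R, ‖H k z‖ ≤ 2 * (A + B + 1) := by
    intro k z hz
    have h1 := hHn k z hz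
    have h2 : |F z| ≤ A := hA z (ball_subset_closedBall hz)
    have h3 := hB z (ball_subset_closedBall hz)
    have h4 : (1 : ℝ) / (k + 1) ≤ 1 := by
      rw [div_le_one (by positivity)]; linarith [Nat.cast_nonneg (α := ℝ) k]
    have h5 := norm_le_norm_sub_add (H k z) (dz F z)
    rw [norm_sub_rev] at h5
    have := norm_nonneg (H k z)
    have := abs_nonneg (F z)
    have := norm_nonneg (dz F z)
    linarith
  obtain ⟨φ, h, hφ, hh, hlim⟩ := exists_subseq_tendsto_holomorphic hr hrR hH hbound
  refine ⟨h, hh, fun z hz => ?_⟩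
  have h1 := hlim z hz
  have h2 : Tendsto (fun k => ‖H (φ k) z‖ / 20 + |F z| / 20 + 1 / ((φ k : ℝ) + 1)) atTop
      (𝓝 (‖h z‖ / 20 + |F z| / 20 + 0)) :=
    ((h1.norm.div_const 20).add_const _).add
      (tendsto_one_div_add_atTop_nhds_zero_nat.comp hφ.tendsto_atTop)
  rw [add_zero] at h2
  exact le_of_tendsto_of_tendsto' ((h1.const_sub (dz F z)).norm) h2
    fun k => hHn (φ k) z (ball_subset_ball hrR.le hz)

/-! ### Holomorphic functions of controlled growth -/

/-- Removal of the zeros in `3/4 𝔻` one at a time. Dividing by `4/5 (z - ζ)` keeps the bound `B` on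
`2 𝔻`, by the maximum principle, and multiplies the value at `z₀` by at least `5/4`, so at most `n`
zeros can be removed. -/
theorem exists_zero_factorization {B : ℝ} {z₀ : ℂ} (hz₀ : ‖z₀‖ ≤ 1 / 4) (n : ℕ) :
    ∀ (h : ℂ → ℂ) (μ : ℝ), DifferentiableOn ℂ h (ball 0 (5 / 2)) →
      (∀ z ∈ closedBall (0 : ℂ) 2, ‖h z‖ ≤ B) → μ ≤ ‖h z₀‖ → B * (4 / 5) ^ n < μ →
      ∃ (m : ℕ) (ζ : Fin m → ℂ) (g : ℂ → ℂ), m ≤ n ∧ DifferentiableOn ℂ g (ball 0 (5 / 2)) ∧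
        (∀ z ∈ closedBall (0 : ℂ) 2, ‖g z‖ ≤ B) ∧ μ ≤ ‖g z₀‖ ∧
        (∀ z ∈ closedBall (0 : ℂ) (3 / 4), g z ≠ 0) ∧
        ∀ z, h z = g z * ∏ j, (4 / 5 * (z - ζ j)) := by
  have hz₀2 : z₀ ∈ closedBall (0 : ℂ) 2 := by simp; linarith
  induction n with
  | zero =>
    intro h μ _ hB hμ hn
    exact absurd (hμ.trans (hB z₀ hz₀2)) (by simpa using hn)
  | succ n ih =>
    intro h μ hh hB hμ hn
    have hB0 : 0 ≤ B := (norm_nonneg _).trans (hB z₀ hz₀2)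
    by_cases h0 : ∀ z ∈ closedBall (0 : ℂ) (3 / 4), h z ≠ 0
    · exact ⟨0, Fin.elim0, h, Nat.zero_le _, hh, hB, hμ, h0, fun z => by simp⟩
    push Not at h0
    obtain ⟨ζ, hζ, hζ0⟩ := h0
    have hζn : ‖ζ‖ ≤ 3 / 4 := by simpa using hζ
    set h₁ : ℂ → ℂ := fun z => 5 / 4 * dslope h ζ z with hh₁
    have hd1 : DifferentiableOn ℂ h₁ (ball 0 (5 / 2)) := by
      refine ((differentiableOn_dslope (isOpen_ball.mem_nhds ?_)).2 hh).const_mul _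
      simp; linarith
    have hfac : ∀ z, h z = 4 / 5 * (z - ζ) * h₁ z := by
      intro z
      have := sub_smul_dslope h ζ z
      rw [hζ0, sub_zero, smul_eq_mul] at this
      simp only [hh₁]
      linear_combination -this
    have hcl : closure (ball (0 : ℂ) 2) = closedBall 0 2 := closure_ball _ two_ne_zero
    -- On `|z| = 2` one has `|z - ζ| ≥ 5/4`.
    have hB1 : ∀ z ∈ closedBall (0 : ℂ) 2, ‖h₁ z‖ ≤ B := by
      intro z hz
      refine Complex.norm_le_of_forall_mem_frontier_norm_le isBounded_ball ?_ ?_ (hcl ▸ hz)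
      · refine (hd1.mono ?_).diffContOnCl
        rw [hcl]
        exact closedBall_subset_ball (by norm_num)
      · intro w hw
        rw [frontier_ball _ two_ne_zero] at hw
        have hw2 : ‖w‖ = 2 := by simpa using hw
        have h1 := hB w (sphere_subset_closedBall hw)
        rw [hfac, norm_mul, norm_mul] at h1
        have h2 : 5 / 4 ≤ ‖w - ζ‖ := by
          have := norm_sub_norm_le w ζ
          linarith
        have h3 : ‖(4 / 5 : ℂ)‖ = 4 / 5 := by norm_num
        rw [h3] at h1
        nlinarith [norm_nonneg (h₁ w)]
    -- At `z₀` one has `|z₀ - ζ| ≤ 1/4 + 3/4`.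
    have hμ1 : μ * (5 / 4) ≤ ‖h₁ z₀‖ := by
      rw [hfac, norm_mul, norm_mul] at hμ
      have h3 : ‖(4 / 5 : ℂ)‖ = 4 / 5 := by norm_num
      rw [h3] at hμ
      have h2 : ‖z₀ - ζ‖ ≤ 1 := by
        have := norm_sub_le z₀ ζ
        linarith
      nlinarith [norm_nonneg (h₁ z₀)]
    obtain ⟨m, ξ, g, hm, hg, hgB, hgμ, hg0, hprod⟩ := ih h₁ (μ * (5 / 4)) hd1 hB1 hμ1 (by
      rw [pow_succ] at hn; linarith)
    have hμ0 : 0 ≤ μ := le_trans (by positivity) hn.le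
    refine ⟨m + 1, Fin.cons ζ ξ, g, by omega, hg, hgB, by linarith, hg0, fun z => ?_⟩
    rw [hfac, hprod, Fin.prod_univ_succ]
    simp only [Fin.cons_zero, Fin.cons_succ]
    ring

/-- A nonvanishing function bounded by `B` has a logarithm with derivative `O(log (B / μ) + 1)`:
apply the Borel–Carathéodory inequality around `z₀` and then Cauchy's estimate. -/
theorem exists_log_of_nonvanishing {B μ : ℝ} {z₀ : ℂ} {g : ℂ → ℂ} (hz₀ : ‖z₀‖ ≤ 1 / 4) (hμ0 : 0 < μ)
    (hg : DifferentiableOn ℂ g (ball 0 (5 / 2))) (hB : ∀ z ∈ closedBall (0 : ℂ) 2, ‖g z‖ ≤ B)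
    (hμ : μ ≤ ‖g z₀‖) (hg0 : ∀ z ∈ closedBall (0 : ℂ) (3 / 4), g z ≠ 0) :
    ∃ G : ℂ → ℂ, ∀ z ∈ ball (0 : ℂ) (1 / 60), ∀ z' ∈ ball (0 : ℂ) (1 / 60),
      g z = g z' * cexp (G z - G z') ∧
      ‖G z - G z'‖ ≤ 80 * (Real.log (B / μ) + 1) * ‖z - z'‖ := by
  have hsub : ball z₀ (1 / 2) ⊆ closedBall 0 (3 / 4) := by
    intro z hz
    have h1 : ‖z - z₀‖ < 1 / 2 := by simpa [dist_eq_norm] using hz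
    have := norm_le_norm_sub_add z z₀
    simp; linarith
  have hsub2 : ball z₀ (1 / 2) ⊆ ball 0 (5 / 2) :=
    hsub.trans (closedBall_subset_ball (by norm_num))
  have hgd : ∀ z ∈ ball z₀ (1 / 2), HasDerivAt g (deriv g z) z := fun z hz =>
    (hg.differentiableAt (isOpen_ball.mem_nhds (hsub2 hz))).hasDerivAt
  have hlog : DifferentiableOn ℂ (fun z => deriv g z / g z) (ball z₀ (1 / 2)) :=
    ((hg.deriv isOpen_ball).mono hsub2).div (hg.mono hsub2) fun z hz => hg0 z (hsub hz)
  obtain ⟨G, hG0, hG⟩ := hlog.isExactOn_ball.with_val_at z₀ 0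
  have hz₀m : z₀ ∈ ball z₀ (1 / 2) := mem_ball_self (by norm_num)
  have hgexp : ∀ z ∈ ball z₀ (1 / 2), g z = g z₀ * cexp (G z) := by
    intro z hz
    have hd : ∀ w ∈ ball z₀ (1 / 2), HasDerivAt (fun z => g z * cexp (-G z)) 0 w := by
      intro w hw
      refine ((hgd w hw).mul (hG w hw).neg.cexp).congr_deriv ?_
      have := hg0 w (hsub hw)
      field_simp
      ring
    have := (convex_ball z₀ (1 / 2)).is_const_of_fderivWithin_eq_zero (𝕜 := ℂ)
      (f := fun z => g z * cexp (-G z)) (fun w hw =>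
          (hd w hw).differentiableAt.differentiableWithinAt)
      (fun w hw => by
        rw [fderivWithin_of_isOpen isOpen_ball hw, (hd w hw).hasFDerivAt.fderiv]
        ext; simp) hz hz₀m
    simp only [hG0, neg_zero, Complex.exp_zero, mul_one] at this
    rw [← this, mul_assoc, ← Complex.exp_add]
    simp
  set N := Real.log (B / μ) + 1 with hN
  have hgz0 : 0 < ‖g z₀‖ := hμ0.trans_le hμ
  have hBμ : μ ≤ B := hμ.trans (hB z₀ (by simp; linarith))
  have hNpos : 0 < N := by
    have : 0 ≤ Real.log (B / μ) := Real.log_nonneg ((one_le_div hμ0).2 hBμ)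
    linarith
  have hre : ∀ z ∈ ball z₀ (1 / 2), (G z).re ≤ N := by
    intro z hz
    have h1 : ‖g z‖ ≤ B := hB z (closedBall_subset_closedBall (by norm_num) (hsub hz))
    rw [hgexp z hz, norm_mul, Complex.norm_exp] at h1
    have h2 : Real.exp (G z).re ≤ B / μ := by
      rw [le_div_iff₀ hμ0]
      nlinarith [Real.exp_pos (G z).re]
    have := Real.log_le_log (Real.exp_pos _) h2
    rw [Real.log_exp] at this
    linarith
  have hGn : ∀ z ∈ ball z₀ (2 / 5), ‖G z‖ ≤ 8 * N := by
    intro z hz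
    have hz' : ‖z - z₀‖ < 2 / 5 := by simpa [dist_eq_norm] using hz
    have hmap : ∀ w ∈ ball (0 : ℂ) (1 / 2), z₀ + w ∈ ball z₀ (1 / 2) := by
      intro w hw; simpa [dist_eq_norm] using hw
    have := Complex.borelCaratheodory_zero (f := fun w => G (z₀ + w)) (M := N) (R := 1 / 2)
      (z := z - z₀) hNpos (fun w hw => by
        have h1 := (hG _ (hmap w hw)).differentiableAt
        have h2 : DifferentiableAt ℂ (fun w => z₀ + w) w := by fun_prop
        exact (DifferentiableAt.comp (f := fun w => z₀ + w) w h1 h2).differentiableWithinAt)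
      (fun w hw => hre _ (hmap w hw)) (by norm_num) (by simp; linarith) (by simp [hG0])
    simp only [add_sub_cancel] at this
    refine this.trans ?_
    rw [div_le_iff₀ (by linarith)]
    nlinarith
  have hsm : ∀ z ∈ ball (0 : ℂ) (1 / 60), closedBall z (1 / 10) ⊆ ball z₀ (2 / 5) := by
    intro z hz w hw
    have h1 : ‖z‖ < 1 / 60 := by simpa using hz
    have h2 : ‖w - z‖ ≤ 1 / 10 := by simpa [dist_eq_norm] using hw
    have h3 : ‖w - z₀‖ ≤ ‖w - z‖ + ‖z‖ + ‖z₀‖ := by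
      have e : w - z₀ = (w - z) + z - z₀ := by ring
      rw [e]
      exact (norm_sub_le _ _).trans (by gcongr; exact norm_add_le _ _)
    rw [mem_ball, dist_eq_norm]; linarith
  have h25 : ball z₀ (2 / 5) ⊆ ball z₀ (1 / 2) := ball_subset_ball (by norm_num)
  refine ⟨G, fun z hz z' hz' => ⟨?_, ?_⟩⟩
  · rw [hgexp z (h25 (hsm z hz (mem_closedBall_self (by norm_num)))),
      hgexp z' (h25 (hsm z' hz' (mem_closedBall_self (by norm_num)))), mul_assoc, ← Complex.exp_add]
    simp
  · refine (convex_ball (0 : ℂ) (1 / 60)).norm_image_sub_le_of_norm_deriv_le (f := G)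
      (fun w hw => ?_) (fun w hw => ?_) hz' hz
    · exact (hG w (h25 (hsm w hw (mem_closedBall_self (by norm_num))))).differentiableAt
    · have := norm_deriv_le_of_forall_mem_sphere_norm_le (f := G) (c := w) (R := 1 / 10)
        (C := 8 * N) (by norm_num) ?_
        (fun z hz => hGn z (hsm w hw (sphere_subset_closedBall hz)))
      · linarith
      · refine DifferentiableOn.diffContOnCl ?_
        rw [closure_ball _ (by norm_num)]
        intro x hx
        exact (hG x (h25 (hsm w hw hx))).differentiableAt.differentiableWithinAt

theorem norm_exp_mul_prod_sub_one_le {ι : Type*} (t : Finset ι) (x : ℂ) (f : ι → ℂ) :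
    ‖cexp x * ∏ i ∈ t, (1 + f i) - 1‖ ≤ Real.exp (‖x‖ + ∑ i ∈ t, ‖f i‖) - 1 := by
  have h1 := t.norm_prod_one_add_sub_one_le f
  have h2 : ‖cexp x - 1‖ ≤ Real.exp ‖x‖ - 1 := by
    simpa using norm_exp_sub_sum_le_exp_norm_sub_sum x 1
  have e : cexp x * ∏ i ∈ t, (1 + f i) - 1
      = cexp x * (∏ i ∈ t, (1 + f i) - 1) + (cexp x - 1) := by ring
  rw [e, Real.exp_add]
  refine (norm_add_le _ _).trans ?_
  rw [norm_mul]
  have h3 := Complex.norm_exp_le_exp_norm x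
  have : ‖cexp x‖ * ‖∏ i ∈ t, (1 + f i) - 1‖ ≤ Real.exp ‖x‖ * (Real.exp (∑ i ∈ t, ‖f i‖) - 1) := by
    gcongr
  linarith

/-- In a disk whose centre `w` is far from all zeros `ζ j`, in the sense that `∑ j, δ / |w - ζ j| ≤
1`, the function `h` has small relative variation at scales below `δ`. -/
theorem norm_sub_le_of_zeros_far {m : ℕ} {ζ : Fin m → ℂ} {h g G : ℂ → ℂ} {L δ : ℝ} {w : ℂ}
    (hδ : 0 < δ)
    (hg0 : ∀ z ∈ ball w δ, g z ≠ 0)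
    (hprod : ∀ z, h z = g z * ∏ j, (4 / 5 * (z - ζ j)))
    (hG : ∀ z ∈ ball w δ, ∀ z' ∈ ball w δ, g z = g z' * cexp (G z - G z') ∧
      ‖G z - G z'‖ ≤ L * ‖z - z'‖)
    (hfar : ∀ j, 2 * δ ≤ ‖w - ζ j‖) (hsum : ∑ j, δ / ‖w - ζ j‖ ≤ 1) :
    ∀ z ∈ ball w δ, ∀ z' ∈ ball w δ, h z' ≠ 0 ∧
      ‖h z - h z'‖ ≤ (Real.exp ((L + 2 / δ) * ‖z - z'‖) - 1) * ‖h z'‖ := by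
  intro z hz z' hz'
  have hz'n : ‖z' - w‖ < δ := by simpa [dist_eq_norm] using hz'
  have hlow : ∀ j, ‖w - ζ j‖ / 2 ≤ ‖z' - ζ j‖ := by
    intro j
    have h1 := hfar j
    have h2 := norm_sub_le_norm_sub_add_norm_sub w z' (ζ j)
    rw [norm_sub_rev w z'] at h2
    linarith
  have hpos : ∀ j, 0 < ‖w - ζ j‖ := fun j => by have := hfar j; linarith
  have hne : ∀ j, z' - ζ j ≠ 0 := fun j => by
    rw [← norm_pos_iff]; have := hlow j; have := hpos j; linarith
  have hh0 : h z' ≠ 0 := by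
    rw [hprod]
    refine mul_ne_zero (hg0 z' hz') (Finset.prod_ne_zero_iff.2 fun j _ => ?_)
    exact mul_ne_zero (by norm_num) (hne j)
  refine ⟨hh0, ?_⟩
  obtain ⟨hg1, hg2⟩ := hG z hz z' hz'
  have e : h z = h z' * (cexp (G z - G z') * ∏ j, (1 + (z - z') / (z' - ζ j))) := by
    rw [hprod, hprod, hg1]
    have : ∏ j, (4 / 5 * (z - ζ j)) = (∏ j, (4 / 5 * (z' - ζ j))) * ∏ j,
        (1 + (z - z') / (z' - ζ j)) := by
      rw [← Finset.prod_mul_distrib]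
      refine Finset.prod_congr rfl fun j _ => ?_
      have := hne j
      field_simp
      ring
    rw [this]; ring
  have e2 : h z - h z' = (cexp (G z - G z') * ∏ j, (1 + (z - z') / (z' - ζ j)) - 1) * h z' := by
    rw [e]; ring
  rw [e2, norm_mul]
  gcongr
  refine (norm_exp_mul_prod_sub_one_le _ _ _).trans ?_
  gcongr
  rw [add_mul]
  refine add_le_add hg2 ?_
  calc ∑ j, ‖(z - z') / (z' - ζ j)‖ ≤ ∑ j, 2 / δ * ‖z - z'‖ * (δ / ‖w - ζ j‖) := by
        refine Finset.sum_le_sum fun j _ => ?_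
        rw [norm_div]
        have := hpos j
        calc ‖z - z'‖ / ‖z' - ζ j‖ ≤ ‖z - z'‖ / (‖w - ζ j‖ / 2) := by
              gcongr
              exact hlow j
          _ = _ := by field_simp
    _ = 2 / δ * ‖z - z'‖ * ∑ j, δ / ‖w - ζ j‖ := by rw [Finset.mul_sum]
    _ ≤ 2 / δ * ‖z - z'‖ * 1 := by gcongr
    _ = _ := mul_one _

/-! ### Counting the disks that see too many zeros -/

theorem integrableOn_norm_sub_inv {E : Set ℂ} (hE : MeasurableSet E) (hv : volume E ≠ ⊤) (ζ : ℂ) :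
    IntegrableOn (fun z : ℂ => ‖z - ζ‖⁻¹) E ∧
      ∫ z in E, ‖z - ζ‖⁻¹ ≤ 2 * Real.pi + volume.real E := by
  have hmp : MeasurePreserving (fun z : ℂ => z + ζ) volume volume := measurePreserving_add_right _ ζ
  have hme : MeasurableEmbedding fun z : ℂ => z + ζ := measurableEmbedding_addRight ζ
  have hE' : MeasurableSet ((fun z : ℂ => z + ζ) ⁻¹' E) := hmp.measurable hE
  have hv' : volume ((fun z : ℂ => z + ζ) ⁻¹' E) = volume E :=
      hmp.measure_preimage hE.nullMeasurableSet
  have hvn : volume ((fun z : ℂ => z + ζ) ⁻¹' E) ≠ ⊤ := by rwa [hv']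
  constructor
  · rw [← hmp.integrableOn_comp_preimage hme]
    refine (integrableOn_norm_inv hE' hvn).congr_fun (fun z _ => by simp) hE'
  · rw [← hmp.setIntegral_preimage_emb hme]
    have := setIntegral_norm_inv_le hE' hvn
    rw [Measure.real, hv'] at this
    simpa [Measure.real] using this

/-- Comparison of the sum with `∫ dA(z) / |z - ζ|` over the disjoint disks of radius `√δ` about the
centres, each of area `π δ`. -/
theorem sum_div_norm_sub_le {δ : ℝ} (hδ : 0 < δ) (hδ1 : δ < 1 / 60) (T : Finset ℂ) (ζ : ℂ)
    (hT : ∀ w ∈ T, ‖w‖ < 1 / 60)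
    (hsep : ∀ w ∈ T, ∀ w' ∈ T, w ≠ w' → 2 * √δ ≤ dist w w')
    (hfar : ∀ w ∈ T, √δ ≤ ‖w - ζ‖) : ∑ w ∈ T, δ / ‖w - ζ‖ ≤ 6 := by
  have hs : 0 < √δ := Real.sqrt_pos.2 hδ
  have hs2 : √δ * √δ = δ := Real.mul_self_sqrt hδ.le
  have hs1 : √δ ≤ 1 / 2 := by
    rw [Real.sqrt_le_left (by norm_num)]; linarith
  have hint := fun E (hE : MeasurableSet E) (hv : volume E ≠ ⊤) => integrableOn_norm_sub_inv hE hv ζ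
  have hterm : ∀ w ∈ T, Real.pi * (δ / ‖w - ζ‖) ≤ 2 * ∫ z in ball w √δ, ‖z - ζ‖⁻¹ := by
    intro w hw
    have hpos : 0 < ‖w - ζ‖ := hs.trans_le (hfar w hw)
    have h1 : ∫ z in ball w √δ, (2 * ‖w - ζ‖)⁻¹ ≤ ∫ z in ball w √δ, ‖z - ζ‖⁻¹ := by
      refine setIntegral_mono_on_ae (integrableOn_const measure_ball_lt_top.ne)
        (hint _ measurableSet_ball measure_ball_lt_top.ne).1 measurableSet_ball ?_
      have hne : ∀ᵐ z : ℂ, z ≠ ζ := by simp [ae_iff]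
      filter_upwards [hne] with z hz hzw
      have hz0 : 0 < ‖z - ζ‖ := norm_pos_iff.2 (sub_ne_zero.2 hz)
      refine inv_anti₀ hz0 ?_
      have h2 : ‖z - w‖ < √δ := by simpa [dist_eq_norm] using hzw
      have h3 := norm_sub_le_norm_sub_add_norm_sub z w ζ
      linarith [hfar w hw]
    have h2 : ∫ z in ball w √δ, (2 * ‖w - ζ‖)⁻¹ = Real.pi * δ * (2 * ‖w - ζ‖)⁻¹ := by
      rw [setIntegral_const, smul_eq_mul]
      congr 1
      simp [Measure.real, ENNReal.toReal_ofReal hs.le]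
      rw [sq, hs2, mul_comm]
    rw [h2] at h1
    calc Real.pi * (δ / ‖w - ζ‖) = 2 * (Real.pi * δ * (2 * ‖w - ζ‖)⁻¹) := by field_simp
      _ ≤ _ := by linarith
  have hdisj : (T : Set ℂ).PairwiseDisjoint fun w => ball w √δ := by
    intro w hw w' hw' hne
    refine ball_disjoint_ball ?_
    have := hsep w hw w' hw' hne
    linarith
  have hsum : ∑ w ∈ T, ∫ z in ball w √δ, ‖z - ζ‖⁻¹ ≤ 3 * Real.pi := by
    rw [← integral_biUnion_finset T (fun w _ => measurableSet_ball) hdisj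
      (fun w _ => (hint _ measurableSet_ball measure_ball_lt_top.ne).1)]
    have h1 := hint (ball (0 : ℂ) 1) measurableSet_ball measure_ball_lt_top.ne
    have hv : volume.real (ball (0 : ℂ) 1) = Real.pi := by simp [Measure.real]
    rw [hv] at h1
    refine (setIntegral_mono_set h1.1 (ae_of_all _ fun z => by positivity) ?_).trans
      (h1.2.trans (by linarith))
    refine LE.le.eventuallyLE ?_
    refine iUnion₂_subset fun w hw z hz => ?_
    have h2 : ‖z - w‖ < √δ := by simpa [dist_eq_norm] using hz
    have h3 := norm_le_norm_sub_add z w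
    have := hT w hw
    simp; linarith
  have : Real.pi * ∑ w ∈ T, δ / ‖w - ζ‖ ≤ Real.pi * 6 := by
    rw [Finset.mul_sum]
    refine (Finset.sum_le_sum hterm).trans ?_
    rw [← Finset.mul_sum]
    linarith
  exact le_of_mul_le_mul_left this Real.pi_pos

open Classical in
/-- All but `7 m` of the separated disks are far from the `m` given points: at most `m` centres are
within `√δ` of one of the points, and Markov's inequality bounds the number of the others. -/
theorem card_filter_zeros_near_le {δ : ℝ} (hδ : 0 < δ) (hδ1 : δ < 1 / 60) (S : Finset ℂ)
    (hS : ∀ w ∈ S, ‖w‖ < 1 / 60)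
    (hsep : ∀ w ∈ S, ∀ w' ∈ S, w ≠ w' → 2 * √δ ≤ dist w w') {m : ℕ} (ζ : Fin m → ℂ) :
    ((S.filter fun w => ¬ ((∀ j, √δ ≤ ‖w - ζ j‖) ∧ ∑ j, δ / ‖w - ζ j‖ ≤ 1)).card : ℝ) ≤ 7 * m := by
  set A := Finset.univ.biUnion fun j => S.filter fun w => ‖w - ζ j‖ < √δ with hA
  set D := S.filter fun w => (∀ j, √δ ≤ ‖w - ζ j‖) ∧ 1 < ∑ j, δ / ‖w - ζ j‖ with hD
  have hsub : (S.filter fun w => ¬ ((∀ j, √δ ≤ ‖w - ζ j‖) ∧ ∑ j, δ / ‖w - ζ j‖ ≤ 1)) ⊆ A ∪ D := by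
    intro w hw
    rw [Finset.mem_filter] at hw
    simp only [hA, hD, Finset.mem_union, Finset.mem_biUnion, Finset.mem_filter, Finset.mem_univ,
        true_and]
    by_cases h : ∀ j, √δ ≤ ‖w - ζ j‖
    · exact Or.inr ⟨hw.1, h, by
        by_contra h'
        exact hw.2 ⟨h, not_lt.1 h'⟩⟩
    · push Not at h
      obtain ⟨j, hj⟩ := h
      exact Or.inl ⟨j, hw.1, hj⟩
  have hAc : A.card ≤ m := by
    refine Finset.card_biUnion_le.trans ?_
    refine (Finset.sum_le_card_nsmul _ _ 1 fun j _ => ?_).trans (by simp)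
    rw [Finset.card_le_one]
    intro w hw w' hw'
    rw [Finset.mem_filter] at hw hw'
    by_contra hne
    have h1 := hsep w hw.1 w' hw'.1 hne
    have h2 := dist_triangle_right w w' (ζ j)
    rw [dist_eq_norm w (ζ j), dist_eq_norm w' (ζ j)] at h2
    linarith [hw.2, hw'.2]
  have hDc : (D.card : ℝ) ≤ 6 * m := by
    have h1 : (D.card : ℝ) ≤ ∑ w ∈ D, ∑ j, δ / ‖w - ζ j‖ := by
      rw [Finset.cast_card]
      refine Finset.sum_le_sum fun w hw => ?_
      exact ((Finset.mem_filter.1 hw).2.2).le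
    rw [Finset.sum_comm] at h1
    refine h1.trans ((Finset.sum_le_card_nsmul _ _ 6 fun j _ => ?_).trans (by simp; linarith))
    refine sum_div_norm_sub_le hδ hδ1 D (ζ j) (fun w hw => hS w (Finset.mem_filter.1 hw).1) ?_ ?_
    · exact fun w hw w' hw' => hsep w (Finset.mem_filter.1 hw).1 w' (Finset.mem_filter.1 hw').1
    · exact fun w hw => (Finset.mem_filter.1 hw).2.1 j
  have h1 : ((A ∪ D).card : ℝ) ≤ A.card + D.card := by exact_mod_cast Finset.card_union_le _ _
  have h2 : ((S.filter fun w => ¬ ((∀ j, √δ ≤ ‖w - ζ j‖) ∧ ∑ j, δ / ‖w - ζ j‖ ≤ 1)).card : ℝ)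
      ≤ (A ∪ D).card := by exact_mod_cast Finset.card_le_card hsub
  have h3 : (A.card : ℝ) ≤ m := by exact_mod_cast hAc
  linarith

/-- Away from an exceptional set of `O(log (B / μ) + 1)` disks, a holomorphic function has bounded
relative variation on the disks of radius `δ`. -/
theorem exists_finset_slowly_varying {B μ δ : ℝ} {z₀ : ℂ} {h : ℂ → ℂ} (hz₀ : ‖z₀‖ ≤ 1 / 4)
    (hμ0 : 0 < μ)
    (hh : DifferentiableOn ℂ h (ball 0 (5 / 2))) (hB : ∀ z ∈ closedBall (0 : ℂ) 2, ‖h z‖ ≤ B)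
    (hμ : μ ≤ ‖h z₀‖) (hδ : 0 < δ) (hδ1 : δ < 1 / 60) (S : Finset ℂ)
    (hS : ∀ w ∈ S, ball w δ ⊆ ball 0 (1 / 60))
    (hsep : ∀ w ∈ S, ∀ w' ∈ S, w ≠ w' → 2 * √δ ≤ dist w w') :
    ∃ E : Finset ℂ, E ⊆ S ∧ (E.card : ℝ) ≤ 35 * (Real.log (B / μ) + 1) ∧
      ∀ w ∈ S, w ∉ E → ∀ z ∈ ball w δ, ∀ z' ∈ ball w δ, h z' ≠ 0 ∧
        ‖h z - h z'‖ ≤ (Real.exp ((80 * (Real.log (B / μ) + 1) + 2 / δ) * ‖z - z'‖) - 1) * ‖h z'‖ :=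
            by
  classical
  have hBμ : μ ≤ B := hμ.trans (hB z₀ (by simp; linarith))
  have hB0 : 0 < B := hμ0.trans_le hBμ
  set N := Real.log (B / μ) with hN
  have hN0 : 0 ≤ N := Real.log_nonneg ((one_le_div hμ0).2 hBμ)
  -- `1 / log (5/4) < 5`.
  have hn : B * (4 / 5) ^ (⌊5 * N⌋₊ + 1) < μ := by
    have h1 : 5 * N < (⌊5 * N⌋₊ + 1 : ℕ) := by
      push_cast; exact Nat.lt_floor_add_one _
    set n := ⌊5 * N⌋₊ + 1
    have h2 : Real.log (4 / 5) ≤ -(1 / 5) := by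
      have := Real.log_le_sub_one_of_pos (show (0 : ℝ) < 4 / 5 by norm_num)
      linarith
    rw [← Real.log_lt_log_iff (by positivity) hμ0, Real.log_mul hB0.ne' (by positivity),
      Real.log_pow]
    have h3 : N = Real.log B - Real.log μ := Real.log_div hB0.ne' hμ0.ne'
    have h4 : (0 : ℝ) ≤ n := Nat.cast_nonneg n
    nlinarith
  obtain ⟨m, ζ, g, hm, hg, hgB, hgμ, hg0, hprod⟩ := exists_zero_factorization hz₀ _ h μ hh hB hμ hn
  obtain ⟨G, hG⟩ := exists_log_of_nonvanishing hz₀ hμ0 hg hgB hgμ hg0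
  have hSn : ∀ w ∈ S, ‖w‖ < 1 / 60 := fun w hw => by simpa using hS w hw (mem_ball_self hδ)
  refine ⟨S.filter fun w => ¬ ((∀ j, √δ ≤ ‖w - ζ j‖) ∧ ∑ j, δ / ‖w - ζ j‖ ≤ 1),
    Finset.filter_subset _ _, ?_, ?_⟩
  · refine (card_filter_zeros_near_le hδ hδ1 S hSn hsep ζ).trans ?_
    have h1 : (m : ℝ) ≤ 5 * N + 1 := by
      have : (m : ℝ) ≤ (⌊5 * N⌋₊ + 1 : ℕ) := by exact_mod_cast hm
      push_cast at this
      linarith [Nat.floor_le (show 0 ≤ 5 * N by positivity)]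
    linarith
  · intro w hw hwE
    simp only [Finset.mem_filter, hw, true_and, not_not] at hwE
    refine norm_sub_le_of_zeros_far hδ (fun z hz => hg0 z ?_) hprod
      (fun z hz z' hz' => hG z (hS w hw hz) z' (hS w hw hz')) (fun j => ?_) hwE.2
    · exact (ball_subset_closedBall.trans (closedBall_subset_closedBall (by norm_num))) (hS w hw hz)
    · refine le_trans ?_ (hwE.1 j)
      rw [Real.le_sqrt (by positivity) hδ.le]
      nlinarith

/-! ### A radial test function -/

variable {p : ℂ} {ρ R : ℝ}

theorem integral_dbar_eq_zero {u : ℂ → ℂ} (hu : ContDiff ℝ 1 u) (hc : HasCompactSupport u) :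
    ∫ z, dbar u z = 0 := by
  have hd : Continuous (fderiv ℝ u) := hu.continuous_fderiv one_ne_zero
  have hv : ∀ v, Integrable fun z => fderiv ℝ u z v := fun v =>
    Continuous.integrable_of_hasCompactSupport (by fun_prop)
      ((hc.fderiv ℝ).comp_left (g := fun L : ℂ →L[ℝ] ℂ => L v) (by simp))
  have hz : ∀ v, ∫ z, fderiv ℝ u z v = 0 := by
    intro v
    have := integral_mul_fderiv_eq_neg_fderiv_mul_of_integrable (f := fun _ : ℂ => (1 : ℂ)) (g := u)
      (v := v) (μ := volume) (by simp) (by simpa using hv v)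
      (by simpa using hu.continuous.integrable_of_hasCompactSupport hc)
      (fun x _ => differentiableAt_const _) (fun x _ => hu.differentiable one_ne_zero x)
    simpa using this
  simp only [dbar]
  rw [integral_div, integral_add (hv 1) ((hv I).const_mul I), integral_const_mul, hz, hz]
  simp

theorem hasDerivAt_max_zero_pow (n : ℕ) (t : ℝ) :
    HasDerivAt (fun t : ℝ => max t 0 ^ (n + 2)) ((n + 2) * max t 0 ^ (n + 1)) t := by
  rcases lt_trichotomy t 0 with h | h | h
  · have : (fun t : ℝ => max t 0 ^ (n + 2)) =ᶠ[𝓝 t] fun _ => 0 := by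
      filter_upwards [gt_mem_nhds h] with s hs
      simp [max_eq_right hs.le]
    refine HasDerivAt.congr_of_eventuallyEq ?_ this
    simpa [max_eq_right h.le] using hasDerivAt_const t (0 : ℝ)
  · subst h
    simp only [max_self, ne_eq, Nat.add_eq_zero_iff, one_ne_zero, and_false, not_false_eq_true,
        zero_pow, mul_zero]
    refine hasDerivAt_iff_isLittleO_nhds_zero.2 ?_
    simp only [zero_add, max_self, ne_eq, Nat.add_eq_zero_iff, OfNat.ofNat_ne_zero, and_false,
      not_false_eq_true, zero_pow, sub_zero, smul_zero]
    refine Asymptotics.IsBigO.trans_isLittleO (g := fun t : ℝ => t ^ (n + 2)) ?_ ?_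
    · refine Asymptotics.IsBigO.of_bound 1 (Eventually.of_forall fun t => ?_)
      rw [norm_pow, norm_pow, one_mul]
      gcongr
      rw [Real.norm_eq_abs, Real.norm_eq_abs, abs_of_nonneg (le_max_right _ _)]
      exact max_le (le_abs_self t) (abs_nonneg t)
    · simpa using Asymptotics.isLittleO_pow_pow (𝕜 := ℝ) (show 1 < n + 2 by omega)
  · have : (fun t : ℝ => max t 0 ^ (n + 2)) =ᶠ[𝓝 t] fun t => t ^ (n + 2) := by
      filter_upwards [lt_mem_nhds h] with s hs
      simp [max_eq_left hs.le]
    refine HasDerivAt.congr_of_eventuallyEq ?_ this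
    rw [max_eq_left h.le]
    exact (hasDerivAt_pow (n + 2) t).congr_deriv (by push_cast; rfl)

theorem contDiff_max_zero_pow (n : ℕ) : ContDiff ℝ 1 (fun t : ℝ => max t 0 ^ (n + 2)) := by
  rw [contDiff_one_iff_deriv]
  refine ⟨fun t => (hasDerivAt_max_zero_pow n t).differentiableAt, ?_⟩
  rw [show deriv (fun t : ℝ => max t 0 ^ (n + 2)) = _ from
    funext fun t => (hasDerivAt_max_zero_pow n t).deriv]
  fun_prop

/-- The radial profile `(1 - |z - p|² / ρ²)₊ ^ k`, supported in the disk of radius `ρ` about `p`.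
It is continuously differentiable for `2 ≤ k`, and its Wirtinger derivative is a multiple of
`z - p` times the profile with exponent `k - 1`. -/
noncomputable def bump (k : ℕ) (p : ℂ) (ρ : ℝ) (z : ℂ) : ℝ :=
  max (1 - ‖z - p‖ ^ 2 / ρ ^ 2) 0 ^ k


theorem bump_nonneg (k : ℕ) (p : ℂ) (ρ : ℝ) (z : ℂ) : 0 ≤ bump k p ρ z :=
  pow_nonneg (le_max_right _ _) _

theorem bump_le_one (k : ℕ) (p : ℂ) (ρ : ℝ) (z : ℂ) : bump k p ρ z ≤ 1 := by
  refine pow_le_one₀ (le_max_right _ _) (max_le ?_ zero_le_one)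
  have : 0 ≤ ‖z - p‖ ^ 2 / ρ ^ 2 := by positivity
  linarith

theorem bump_eq_zero (k : ℕ) (hρ : 0 < ρ) {z : ℂ} (hz : z ∉ ball p ρ) : bump (k + 1) p ρ z = 0 := by
  have h1 : ρ ≤ ‖z - p‖ := by simpa [dist_eq_norm] using hz
  have h2 : 1 ≤ ‖z - p‖ ^ 2 / ρ ^ 2 := by
    rw [one_le_div (by positivity)]; gcongr
  rw [bump, max_eq_right (by linarith)]
  simp

theorem contDiff_bump (n : ℕ) (p : ℂ) (ρ : ℝ) : ContDiff ℝ 1 fun z => ((bump (n + 2) p ρ z : ℝ) : ℂ)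
    := by
  have h : ContDiff ℝ 1 fun z : ℂ => 1 - ‖z - p‖ ^ 2 / ρ ^ 2 :=
    contDiff_const.sub (((contDiff_id.sub contDiff_const).norm_sq ℝ).div_const _)
  exact ofRealCLM.contDiff.comp ((contDiff_max_zero_pow n).comp h)

theorem tsupport_bump (n : ℕ) (hρ : 0 < ρ) :
    tsupport (fun z => ((bump (n + 2) p ρ z : ℝ) : ℂ)) ⊆ closedBall p ρ := by
  refine closure_minimal (fun z hz => ?_) isClosed_closedBall
  by_contra h
  refine hz ?_
  simp only [ofReal_eq_zero]
  exact bump_eq_zero _ hρ fun h' => h (ball_subset_closedBall h')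

theorem hasCompactSupport_bump (n : ℕ) (hρ : 0 < ρ) :
    HasCompactSupport fun z => ((bump (n + 2) p ρ z : ℝ) : ℂ) :=
  (isCompact_closedBall p ρ).of_isClosed_subset isClosed_closure (tsupport_bump n hρ)

theorem dbar_bump (n : ℕ) (p : ℂ) (ρ : ℝ) (z : ℂ) :
    dbar (fun z => ((bump (n + 2) p ρ z : ℝ) : ℂ)) z =
      -((n + 2 : ℝ) / ρ ^ 2 * bump (n + 1) p ρ z : ℝ) * (z - p) := by
  have h0 : HasFDerivAt (fun z : ℂ => ‖z - p‖ ^ 2) _ z :=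
    ((hasFDerivAt_id z).sub_const p).norm_sq
  have h1 : HasFDerivAt (fun z : ℂ => 1 - ‖z - p‖ ^ 2 / ρ ^ 2) _ z :=
    (h0.mul_const (ρ ^ 2)⁻¹).const_sub 1
  have h2 := ofRealCLM.hasFDerivAt.comp z ((hasDerivAt_max_zero_pow n _).comp_hasFDerivAt z h1)
  have hv : ∀ v, fderiv ℝ (fun z => ((bump (n + 2) p ρ z : ℝ) : ℂ)) z v =
      ((-((n + 2 : ℝ) / ρ ^ 2 * bump (n + 1) p ρ z) * (2 * inner ℝ (z - p) v) : ℝ) : ℂ) := by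
    intro v
    rw [show fderiv ℝ (fun z => ((bump (n + 2) p ρ z : ℝ) : ℂ)) z = _ from h2.fderiv]
    simp only [bump, ContinuousLinearMap.comp_apply, ofRealCLM_apply, ofReal_inj]
    simp
    ring
  have h3 : inner ℝ (z - p) 1 = (z - p).re := by simp [Complex.inner]
  have h4 : inner ℝ (z - p) I = (z - p).im := by
    simp [Complex.inner]; ring
  rw [dbar, hv, hv, h3, h4]
  conv_rhs => rw [← re_add_im (z - p)]
  push_cast
  ring

/-- The mean value property. It holds because `(z - p) (1 - |z - p|² / ρ²)₊²` is, up to a constant,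
the Wirtinger derivative of `(1 - |z - p|² / ρ²)₊³`, so that the integral against the holomorphic
function `(h z - h p) / (z - p)` vanishes. -/
theorem integral_bump_mul_holomorphic {h : ℂ → ℂ} {R : ℝ} (hρ : 0 < ρ) (hρR : ρ < R)
    (hh : DifferentiableOn ℂ h (ball p R)) :
    ∫ z, (bump 2 p ρ z : ℂ) * h z = (∫ z, (bump 2 p ρ z : ℂ)) * h p := by
  have hp : p ∈ ball p R := mem_ball_self (hρ.trans hρR)
  have hk : DifferentiableOn ℂ (dslope h p) (ball p R) :=
    (differentiableOn_dslope (isOpen_ball.mem_nhds hp)).2 hh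
  have hkd : ContDiffOn ℝ 1 (dslope h p) (ball p R) :=
    (hk.contDiffOn isOpen_ball).restrict_scalars ℝ
  have hhd : ContDiffOn ℝ 1 h (ball p R) := (hh.contDiffOn isOpen_ball).restrict_scalars ℝ
  have hsub : ∀ n, tsupport (fun z => ((bump (n + 2) p ρ z : ℝ) : ℂ)) ⊆ ball p R := fun n =>
    (tsupport_bump n hρ).trans (closedBall_subset_ball hρR)
  have h3 := integral_dbar_eq_zero (contDiff_cutoff_mul isOpen_ball (contDiff_bump 1 p ρ) (hsub 1)
      hkd)
    (hasCompactSupport_bump 1 hρ).mul_right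
  have e : ∀ z, dbar (fun z => (bump (1 + 2) p ρ z : ℂ) * dslope h p z) z
      = -(3 / ρ ^ 2 : ℝ) * ((bump 2 p ρ z : ℂ) * h z - (bump 2 p ρ z : ℂ) * h p) := by
    intro z
    by_cases hz : z ∈ ball p R
    · have hkz := hk.differentiableAt (isOpen_ball.mem_nhds hz)
      rw [dbar_mul ((contDiff_bump 1 p ρ).differentiable one_ne_zero z) (hkz.restrictScalars ℝ),
          dbar_bump]
      have hk0 : dbar (dslope h p) z = 0 := by
        have := (differentiableAt_complex_iff_differentiableAt_real.1 hkz).2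
        rw [dbar, this, smul_eq_mul]
        linear_combination (fderiv ℝ (dslope h p) z 1) / 2 * I_sq
      have := sub_smul_dslope h p z
      rw [smul_eq_mul] at this
      rw [hk0]
      push_cast
      linear_combination -(3 / ρ ^ 2) * (bump 2 p ρ z : ℂ) * this
    · have h0 : z ∉ tsupport (fun z => ((bump (1 + 2) p ρ z : ℝ) : ℂ)) := fun h => hz (hsub 1 h)
      rw [bump_eq_zero 1 hρ fun h => hz (ball_subset_ball hρR.le h)]
      have : dbar (fun z => (bump (1 + 2) p ρ z : ℂ) * dslope h p z) z = 0 :=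
        image_eq_zero_of_notMem_tsupport fun h =>
          h0 (tsupport_mul_subset_left (tsupport_dbar_subset _ h))
      rw [this]; simp
  simp only [e] at h3
  have hi1 : Integrable fun z => (bump 2 p ρ z : ℂ) * h z :=
    (contDiff_cutoff_mul isOpen_ball (contDiff_bump 0 p ρ) (hsub 0)
        hhd).continuous.integrable_of_hasCompactSupport
      (hasCompactSupport_bump 0 hρ).mul_right
  have hi2 : Integrable fun z => (bump 2 p ρ z : ℂ) :=
    (contDiff_bump 0 p ρ).continuous.integrable_of_hasCompactSupport (hasCompactSupport_bump 0 hρ)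
  rw [integral_const_mul, integral_sub hi1 (hi2.mul_const _), integral_mul_const, mul_eq_zero] at h3
  rcases h3 with h3 | h3
  · rw [neg_eq_zero, ofReal_eq_zero] at h3
    exact absurd h3 (by positivity)
  · exact sub_eq_zero.1 h3

theorem integrable_bump (n : ℕ) (hρ : 0 < ρ) : Integrable fun z => bump (n + 2) p ρ z := by
  have : Integrable fun z => ((bump (n + 2) p ρ z : ℝ) : ℂ) :=
    (contDiff_bump n p ρ).continuous.integrable_of_hasCompactSupport (hasCompactSupport_bump n hρ)
  simpa using this.re

theorem le_integral_bump (hρ : 0 < ρ) : 2 / 5 * ρ ^ 2 ≤ ∫ z, bump 2 p ρ z := by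
  have h1 : ∫ z in ball p (ρ / 2), (9 / 16 : ℝ) ≤ ∫ z in ball p (ρ / 2), bump 2 p ρ z := by
    refine setIntegral_mono_on (integrableOn_const measure_ball_lt_top.ne)
      (integrable_bump 0 hρ).integrableOn measurableSet_ball fun z hz => ?_
    have h2 : ‖z - p‖ < ρ / 2 := by simpa [dist_eq_norm] using hz
    have h3 : ‖z - p‖ ^ 2 / ρ ^ 2 ≤ 1 / 4 := by
      rw [div_le_iff₀ (by positivity)]
      nlinarith [norm_nonneg (z - p)]
    have h4 : 3 / 4 ≤ max (1 - ‖z - p‖ ^ 2 / ρ ^ 2) 0 := le_max_of_le_left (by linarith)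
    rw [bump]
    nlinarith
  have h2 : ∫ z in ball p (ρ / 2), bump 2 p ρ z ≤ ∫ z, bump 2 p ρ z :=
    setIntegral_le_integral (integrable_bump 0 hρ) (ae_of_all _ fun z => bump_nonneg _ _ _ _)
  refine le_trans ?_ (h1.trans h2)
  rw [setIntegral_const]
  have : volume.real (ball p (ρ / 2)) = Real.pi * (ρ / 2) ^ 2 := by
    simp [Measure.real, ENNReal.toReal_ofReal (show 0 ≤ ρ / 2 by positivity)]; ring
  rw [this, smul_eq_mul]
  nlinarith [Real.pi_gt_three, sq_nonneg ρ]

/-! ### Interior estimates for the holomorphic factor -/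

/-- Integration by parts moves the derivative from `F` to the bump function, whose Wirtinger
derivative is at most `2 / ρ`. -/
theorem norm_integral_bump_mul_dz_le {F : ℂ → ℝ} (hρ : 0 < ρ) (hρR : ρ < R)
    (hF : ContDiffOn ℝ 2 F (ball p R)) :
    ‖∫ z, (bump 2 p ρ z : ℂ) * dz F z‖ ≤ 2 / ρ * ∫ z in ball p ρ, |F z| := by
  have hFc : ContDiffOn ℝ 1 (fun z => (F z : ℂ)) (ball p R) :=
    ofRealCLM.contDiff.comp_contDiffOn (hF.of_le (by norm_num))
  have hη := contDiff_bump 0 p ρ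
  have hηs : tsupport (fun z => ((bump (0 + 2) p ρ z : ℝ) : ℂ)) ⊆ ball p R :=
    (tsupport_bump 0 hρ).trans (closedBall_subset_ball hρR)
  have hu : ContDiff ℝ 1 fun z => (bump (0 + 2) p ρ z : ℂ) * (F z : ℂ) :=
    contDiff_cutoff_mul isOpen_ball hη hηs hFc
  have huc : HasCompactSupport fun z => (bump (0 + 2) p ρ z : ℂ) * (F z : ℂ) :=
    (hasCompactSupport_bump 0 hρ).mul_right
  have h0 := integral_dbar_eq_zero hu huc
  have hdu : Integrable (dbar fun z => (bump (0 + 2) p ρ z : ℂ) * (F z : ℂ)) :=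
    (continuous_dbar hu).integrable_of_hasCompactSupport
      (huc.isCompact.of_isClosed_subset isClosed_closure (tsupport_dbar_subset _))
  have hFi : IntegrableOn (fun z => |F z|) (ball p ρ) :=
    ((hF.continuousOn.mono (closedBall_subset_ball hρR)).abs.integrableOn_compact
      (isCompact_closedBall p ρ)).mono_set ball_subset_closedBall
  have hdη : ∀ z, ‖dbar (fun z => ((bump (0 + 2) p ρ z : ℝ) : ℂ)) z * F z‖ ≤
      (ball p ρ).indicator (fun z => 2 / ρ * |F z|) z := by
    intro z
    rw [dbar_bump]
    by_cases hz : z ∈ ball p ρ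
    · rw [indicator_of_mem hz, norm_mul, norm_mul, norm_neg, norm_real, norm_real, Real.norm_eq_abs,
        Real.norm_eq_abs]
      gcongr
      have h1 : ‖z - p‖ ≤ ρ := by simpa [dist_eq_norm] using (ball_subset_closedBall hz)
      have h2 := bump_le_one (0 + 1) p ρ z
      have h3 := bump_nonneg (0 + 1) p ρ z
      rw [abs_of_nonneg (by positivity)]
      calc ((0 : ℕ) + 2 : ℝ) / ρ ^ 2 * bump (0 + 1) p ρ z * ‖z - p‖ ≤ ((0 : ℕ) + 2 : ℝ)
          / ρ ^ 2 * 1 * ρ := by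
            gcongr
        _ = 2 / ρ := by field_simp; simp
    · rw [indicator_of_notMem hz, bump_eq_zero 0 hρ hz]
      simp
  have e : ∀ z, (bump 2 p ρ z : ℂ) * dz F z =
      conj (dbar (fun z => (bump (0 + 2) p ρ z : ℂ) * (F z : ℂ)) z)
        - conj (dbar (fun z => ((bump (0 + 2) p ρ z : ℝ) : ℂ)) z * F z) := by
    intro z
    by_cases hz : z ∈ ball p R
    · have hn := isOpen_ball.mem_nhds hz
      rw [dbar_mul (hη.differentiable one_ne_zero z)
          ((hFc.contDiffAt hn).differentiableAt one_ne_zero),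
        dbar_ofReal ((hF.contDiffAt hn).differentiableAt two_ne_zero)]
      simp
    · have h0 : z ∉ tsupport (fun z => ((bump (0 + 2) p ρ z : ℝ) : ℂ)) := fun h => hz (hηs h)
      have h1 : dbar (fun z => ((bump (0 + 2) p ρ z : ℝ) : ℂ)) z = 0 :=
        image_eq_zero_of_notMem_tsupport fun h => h0 (tsupport_dbar_subset _ h)
      have h2 : dbar (fun z => (bump (0 + 2) p ρ z : ℂ) * (F z : ℂ)) z = 0 :=
        image_eq_zero_of_notMem_tsupport fun h =>
          h0 (tsupport_mul_subset_left (tsupport_dbar_subset _ h))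
      rw [h1, h2, bump_eq_zero 1 hρ fun h => hz (ball_subset_ball hρR.le h)]
      simp
  have hηF : Integrable fun z => dbar (fun z => ((bump (0 + 2) p ρ z : ℝ) : ℂ)) z * F z := by
    have hcont : Continuous fun z => dbar (fun z => ((bump (0 + 2) p ρ z : ℝ) : ℂ)) z * F z := by
      refine continuous_iff_continuousAt.2 fun z => ?_
      by_cases hz : z ∈ ball p R
      · exact (continuous_dbar hη).continuousAt.mul
          (hFc.continuousOn.continuousAt (isOpen_ball.mem_nhds hz))
      · refine (continuousAt_const (y := (0 : ℂ))).congr ?_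
        have h0 : z ∉ tsupport (dbar fun z => ((bump (0 + 2) p ρ z : ℝ) : ℂ)) := fun h =>
          hz (hηs (tsupport_dbar_subset _ h))
        filter_upwards [notMem_tsupport_iff_eventuallyEq.1 h0] with w hw
        rw [hw]; simp
    refine hcont.integrable_of_hasCompactSupport (HasCompactSupport.mul_right ?_)
    exact (hasCompactSupport_bump 0 hρ).isCompact.of_isClosed_subset isClosed_closure
      (tsupport_dbar_subset _)
  have hcj : ∀ u : ℂ → ℂ, Integrable u → Integrable fun z => conj (u z) := fun u hu =>
    conjCLE.integrable_comp_iff.2 hu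
  simp_rw [e]
  rw [integral_sub (hcj _ hdu) (hcj _ hηF), integral_conj, integral_conj, h0, map_zero, zero_sub,
    norm_neg, RCLike.norm_conj]
  refine (norm_integral_le_of_norm_le ((integrable_indicator_iff measurableSet_ball).2
    (hFi.const_mul _)) (ae_of_all _ hdη)).trans ?_
  rw [integral_indicator measurableSet_ball, integral_const_mul]

theorem norm_mul_integral_bump_le {F : ℂ → ℝ} {h : ℂ → ℂ} {X : ℝ} (hρ : 0 < ρ) (hρR : ρ < R)
    (hF : ContDiffOn ℝ 2 F (ball p R)) (hh : DifferentiableOn ℂ h (ball p R))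
    (hsim : ∀ z ∈ ball p R, ‖dz F z - h z‖ ≤ ‖h z‖ / 20 + |F z| / 20)
    (hX : ∀ z ∈ ball p ρ, ‖h z‖ ≤ X) :
    ‖h p‖ * ∫ z, bump 2 p ρ z ≤
      (2 / ρ + 1 / 20) * (∫ z in ball p ρ, |F z|) + X / 20 * ∫ z, bump 2 p ρ z := by
  have hη := contDiff_bump 0 p ρ
  have hηs : tsupport (fun z => ((bump 2 p ρ z : ℝ) : ℂ)) ⊆ ball p R :=
    (tsupport_bump 0 hρ).trans (closedBall_subset_ball hρR)
  have hηc : HasCompactSupport fun z => ((bump 2 p ρ z : ℝ) : ℂ) := hasCompactSupport_bump 0 hρ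
  have hhd : ContDiffOn ℝ 1 h (ball p R) := (hh.contDiffOn isOpen_ball).restrict_scalars ℝ
  have hi1 : Integrable fun z => (bump 2 p ρ z : ℂ) * h z :=
    (contDiff_cutoff_mul isOpen_ball hη hηs hhd).continuous.integrable_of_hasCompactSupport
      hηc.mul_right
  have hi2 : Integrable fun z => (bump 2 p ρ z : ℂ) * dz F z :=
    (contDiff_cutoff_mul isOpen_ball hη hηs
        (contDiffOn_dz isOpen_ball hF)).continuous.integrable_of_hasCompactSupport
      hηc.mul_right
  have hJ : 0 ≤ ∫ z, bump 2 p ρ z := integral_nonneg fun z => bump_nonneg _ _ _ _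
  have hFi : IntegrableOn (fun z => |F z|) (ball p ρ) :=
    ((hF.continuousOn.mono (closedBall_subset_ball hρR)).abs.integrableOn_compact
      (isCompact_closedBall p ρ)).mono_set ball_subset_closedBall
  have h1 := integral_bump_mul_holomorphic hρ hρR hh
  have h2 := norm_integral_bump_mul_dz_le hρ hρR hF
  have h3 : ‖∫ z, ((bump 2 p ρ z : ℂ) * dz F z - (bump 2 p ρ z : ℂ) * h z)‖ ≤
      ∫ z, (bump 2 p ρ z * (X / 20) + (ball p ρ).indicator (fun z => |F z| / 20) z) := by
    refine norm_integral_le_of_norm_le (((integrable_bump 0 hρ).mul_const _).add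
      ((integrable_indicator_iff measurableSet_ball).2 (hFi.div_const 20)))
          (ae_of_all _ fun z => ?_)
    by_cases hz : z ∈ ball p ρ
    · rw [indicator_of_mem hz, ← mul_sub, norm_mul, norm_real,
        Real.norm_of_nonneg (bump_nonneg _ _ _ _)]
      have h4 := hsim z (ball_subset_ball hρR.le hz)
      have h5 := hX z hz
      have h6 := bump_le_one 2 p ρ z
      have h7 := bump_nonneg 2 p ρ z
      calc _ ≤ bump 2 p ρ z * (X / 20 + |F z| / 20) := by gcongr; linarith
        _ ≤ bump 2 p ρ z * (X / 20) + 1 * (|F z| / 20) := by rw [mul_add]; gcongr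
        _ = _ := by rw [one_mul]
    · rw [indicator_of_notMem hz, bump_eq_zero 1 hρ hz]
      simp
  rw [integral_add ((integrable_bump 0 hρ).mul_const _)
    ((integrable_indicator_iff measurableSet_ball).2 (hFi.div_const 20)),
    integral_indicator measurableSet_ball, integral_mul_const, integral_div] at h3
  have hJc : ∫ z, (bump 2 p ρ z : ℂ) = ((∫ z, bump 2 p ρ z : ℝ) : ℂ) := integral_complex_ofReal
  rw [integral_sub hi2 hi1, h1, hJc, norm_sub_rev, zero_add] at h3
  have h4 := norm_sub_norm_le (((∫ z, bump 2 p ρ z : ℝ) : ℂ) * h p)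
      (∫ z, (bump 2 p ρ z : ℂ) * dz F z)
  rw [norm_mul, norm_real, Real.norm_of_nonneg hJ] at h4
  linarith

/-- Interior gradient estimate for the holomorphic factor. The error term involving `|h|` is
absorbed by working at a maximum point of `(5/2 - |z|) |h z|`. -/
theorem norm_le_of_abs_le {F : ℂ → ℝ} {h : ℂ → ℂ} {A r : ℝ} (hr : 5 / 2 < r)
    (hF : ContDiffOn ℝ 2 F (ball 0 r)) (hh : DifferentiableOn ℂ h (ball 0 r))
    (hsim : ∀ z ∈ ball (0 : ℂ) r, ‖dz F z - h z‖ ≤ ‖h z‖ / 20 + |F z| / 20)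
    (hA : ∀ z ∈ ball (0 : ℂ) (5 / 2), |F z| ≤ A) :
    ∀ z ∈ closedBall (0 : ℂ) 2, ‖h z‖ ≤ 80 * A := by
  have hsub : closedBall (0 : ℂ) (5 / 2) ⊆ ball 0 r := closedBall_subset_ball hr
  have hA0 : 0 ≤ A := (abs_nonneg _).trans (hA 0 (by simp))
  obtain ⟨p, hp, hmax⟩ := (isCompact_closedBall (0 : ℂ) (5 / 2)).exists_isMaxOn
    (nonempty_closedBall.2 (by norm_num)) (f := fun z => (5 / 2 - ‖z‖) * ‖h z‖)
    ((continuousOn_const.sub continuous_norm.continuousOn).mul (hh.continuousOn.mono hsub).norm)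
  set Q := (5 / 2 - ‖p‖) * ‖h p‖ with hQ
  have hp' : ‖p‖ ≤ 5 / 2 := by simpa using hp
  have hmax' : ∀ z, ‖z‖ ≤ 5 / 2 → (5 / 2 - ‖z‖) * ‖h z‖ ≤ Q := fun z hz => hmax (by simpa using hz)
  have hQA : Q ≤ 40 * A := by
    rcases hp'.eq_or_lt with heq | hlt
    · rw [hQ, heq]; simp; exact hA0
    set d := (5 / 2 - ‖p‖) / 2 with hd
    have hd0 : 0 < d := by rw [hd]; linarith
    have hd1 : d ≤ 5 / 4 := by rw [hd]; linarith [norm_nonneg p]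
    have hpn : ‖p‖ = 5 / 2 - 2 * d := by rw [hd]; ring
    have hQd : Q = 2 * d * ‖h p‖ := by rw [hQ, hpn]; ring
    have hball : ∀ z ∈ ball p (2 * d), ‖z‖ < 5 / 2 := by
      intro z hz
      have h1 : ‖z - p‖ < 2 * d := by simpa [dist_eq_norm] using hz
      have := norm_le_norm_sub_add z p
      linarith
    have hball' : ball p (2 * d) ⊆ ball 0 r := fun z hz => by
      have := hball z hz; simp; linarith
    have hX : ∀ z ∈ ball p d, ‖h z‖ ≤ Q / d := by
      intro z hz
      have h1 : ‖z - p‖ < d := by simpa [dist_eq_norm] using hz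
      have h2 := norm_le_norm_sub_add z p
      rw [le_div_iff₀ hd0]
      have h3 := hmax' z (by linarith)
      nlinarith [norm_nonneg (h z)]
    have h1 := norm_mul_integral_bump_le hd0 (by linarith : d < 2 * d) (hF.mono hball')
        (hh.mono hball')
      (fun z hz => hsim z (hball' hz)) hX
    have hJ := le_integral_bump (p := p) hd0
    set J := ∫ z, bump 2 p d z
    have h2 : ∫ z in ball p d, |F z| ≤ A * (Real.pi * d ^ 2) := by
      have h3 : ‖∫ z in ball p d, |F z|‖ ≤ A * volume.real (ball p d) := by
        refine norm_setIntegral_le_of_norm_le_const measure_ball_lt_top fun z hz => ?_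
        rw [Real.norm_eq_abs, abs_abs]
        refine hA z ?_
        simpa using hball z (ball_subset_ball (by linarith) hz)
      have h4 : volume.real (ball p d) = Real.pi * d ^ 2 := by
        simp [Measure.real, ENNReal.toReal_ofReal hd0.le]; ring
      rw [h4] at h3
      exact (le_abs_self _).trans h3
    have h5 : (2 / d + 1 / 20) * ∫ z in ball p d, |F z| ≤ 7 * A * d := by
      calc _ ≤ (2 / d + 1 / 20) * (A * (Real.pi * d ^ 2)) := by gcongr
        _ = Real.pi * (A * d * (2 + d / 20)) := by field_simp
        _ ≤ 3.15 * (A * d * (2 + (5 / 4) / 20)) := by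
            gcongr
            exact Real.pi_lt_d2.le
        _ ≤ _ := by nlinarith [mul_nonneg hA0 hd0.le]
    have hJ0 : 0 < J := lt_of_lt_of_le (by positivity) hJ
    have hh0 := norm_nonneg (h p)
    have e : Q / d = 2 * ‖h p‖ := by rw [hQd]; field_simp
    rw [e] at h1
    have h6 : 9 / 10 * ‖h p‖ * J ≤ 7 * A * d := by linarith
    have h7 : 9 / 10 * ‖h p‖ * (2 / 5 * d ^ 2) ≤ 7 * A * d :=
      le_trans (by gcongr) h6
    have h8 : (9 / 10 * ‖h p‖ * (2 / 5 * d)) * d ≤ (7 * A) * d := by linarith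
    have h9 := le_of_mul_le_mul_right h8 hd0
    rw [hQd]
    linarith
  intro z hz
  have hz' : ‖z‖ ≤ 2 := by simpa using hz
  have := hmax' z (by linarith)
  nlinarith [norm_nonneg (h z)]

/-- A lower bound for the mean square of `F` at scale `ρ` where `h` does not grow. -/
theorem sq_norm_mul_le_integral_sq {F : ℂ → ℝ} {h : ℂ → ℂ} (hρ : 0 < ρ) (hρ1 : ρ ≤ 1) (hρR : ρ < R)
    (hF : ContDiffOn ℝ 2 F (ball p R)) (hh : DifferentiableOn ℂ h (ball p R))
    (hsim : ∀ z ∈ ball p R, ‖dz F z - h z‖ ≤ ‖h z‖ / 20 + |F z| / 20)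
    (hX : ∀ z ∈ ball p ρ, ‖h z‖ ≤ 2 * ‖h p‖) :
    ‖h p‖ ^ 2 * ρ ^ 4 ≤ 260 * ∫ z in ball p ρ, F z ^ 2 := by
  have h1 := norm_mul_integral_bump_le hρ hρR hF hh hsim hX
  have hJ := le_integral_bump (p := p) hρ
  set J := ∫ z, bump 2 p ρ z
  set A := ∫ z in ball p ρ, |F z| with hA
  have hA0 : 0 ≤ A := integral_nonneg fun z => abs_nonneg _
  have hcont := hF.continuousOn.mono (closedBall_subset_ball hρR)
  have hFi : IntegrableOn (fun z => |F z|) (ball p ρ) :=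
    (hcont.abs.integrableOn_compact (isCompact_closedBall p ρ)).mono_set ball_subset_closedBall
  have hF2 : IntegrableOn (fun z => F z ^ 2) (ball p ρ) :=
    ((hcont.pow 2).integrableOn_compact (isCompact_closedBall p ρ)).mono_set ball_subset_closedBall
  have hvol : volume.real (ball p ρ) = Real.pi * ρ ^ 2 := by
    simp [Measure.real, ENNReal.toReal_ofReal hρ.le]; ring
  set V := Real.pi * ρ ^ 2 with hV
  have hV0 : 0 < V := by positivity
  -- Cauchy–Schwarz, from the nonnegativity of the variance of `|F|` over the disk.
  have hCS : A ^ 2 ≤ V * ∫ z in ball p ρ, F z ^ 2 := by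
    have h2 : 0 ≤ ∫ z in ball p ρ, (F z ^ 2 - 2 * (A / V) * |F z| + (A / V) ^ 2) := by
      refine integral_nonneg fun z => ?_
      have : F z ^ 2 = |F z| ^ 2 := (sq_abs _).symm
      simp only [Pi.zero_apply]
      nlinarith [sq_nonneg (|F z| - A / V)]
    have hs : IntegrableOn (fun z => F z ^ 2 - 2 * (A / V) * |F z|) (ball p ρ) :=
      hF2.sub (hFi.const_mul _)
    rw [integral_add hs (integrableOn_const measure_ball_lt_top.ne),
      integral_sub hF2 (hFi.const_mul _), integral_const_mul, setIntegral_const, hvol, ← hA,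
          smul_eq_mul] at h2
    have e : V * (A / V) ^ 2 = A ^ 2 / V := by field_simp
    have e2 : 2 * (A / V) * A = 2 * (A ^ 2 / V) := by ring
    rw [e, e2] at h2
    have : A ^ 2 / V ≤ ∫ z in ball p ρ, F z ^ 2 := by linarith
    rw [div_le_iff₀ hV0] at this
    linarith
  have hh0 := norm_nonneg (h p)
  have h3 : (2 / ρ + 1 / 20) * A ≤ 3 / ρ * A := by
    gcongr
    have : 1 / 20 ≤ 1 / ρ := by
      gcongr; linarith
    calc 2 / ρ + 1 / 20 ≤ 2 / ρ + 1 / ρ := by gcongr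
      _ = _ := by ring
  have h4 : 9 / 10 * ‖h p‖ * (2 / 5 * ρ ^ 2) ≤ 3 / ρ * A := by
    calc _ ≤ 9 / 10 * ‖h p‖ * J := by gcongr
      _ ≤ _ := by linarith
  have h5 : ‖h p‖ * ρ ^ 3 ≤ 9 * A := by
    have : 9 / 10 * ‖h p‖ * (2 / 5 * ρ ^ 2) * ρ ≤ 3 / ρ * A * ρ := by gcongr
    have e : 3 / ρ * A * ρ = 3 * A := by field_simp
    rw [e] at this
    nlinarith
  have h6 : (‖h p‖ * ρ ^ 3) ^ 2 ≤ (9 * A) ^ 2 := by gcongr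
  have hI0 : 0 ≤ ∫ z in ball p ρ, F z ^ 2 := integral_nonneg fun z => sq_nonneg _
  have h7 : ‖h p‖ ^ 2 * ρ ^ 4 * ρ ^ 2 ≤ (260 * ∫ z in ball p ρ, F z ^ 2) * ρ ^ 2 := by
    calc _ = (‖h p‖ * ρ ^ 3) ^ 2 := by ring
      _ ≤ 81 * A ^ 2 := by linarith
      _ ≤ 81 * (V * ∫ z in ball p ρ, F z ^ 2) := by linarith
      _ = (81 * Real.pi * ∫ z in ball p ρ, F z ^ 2) * ρ ^ 2 := by rw [hV]; ring
      _ ≤ _ := by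
          gcongr
          linarith [Real.pi_lt_d2]
  exact le_of_mul_le_mul_right h7 (by positivity)

/-! ### Growth of the solution in a single disk -/

theorem norm_fderiv_le (F : ℂ → ℝ) (z : ℂ) : ‖fderiv ℝ F z‖ ≤ 2 * ‖dz F z‖ := by
  refine ContinuousLinearMap.opNorm_le_bound _ (by positivity) fun v => ?_
  have h1 : fderiv ℝ F z v = 2 * (dz F z * v).re := by
    have : v = v.re • (1 : ℂ) + v.im • I := by simp
    rw [this, map_add, map_smul, map_smul]
    simp [dz]
    ring
  rw [h1, norm_mul]
  have := abs_re_le_norm (dz F z * v)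
  rw [norm_mul] at this
  simp only [Real.norm_eq_abs] at *
  rw [abs_of_pos two_pos]
  linarith

/-- Mean value inequality for `F`, with the gradient bounded through `h`. -/
theorem abs_sub_le_of_similarity {F : ℂ → ℝ} {h : ℂ → ℂ} {p : ℂ} {ρ K m : ℝ}
    (hF : ∀ z ∈ ball p ρ, DifferentiableAt ℝ F z)
    (hsim : ∀ z ∈ ball p ρ, ‖dz F z - h z‖ ≤ ‖h z‖ / 20 + |F z| / 20)
    (hK : ∀ z ∈ ball p ρ, ‖h z‖ ≤ K) (hm : ∀ z ∈ ball p ρ, |F z| ≤ m) :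
    ∀ z ∈ ball p ρ, ∀ z' ∈ ball p ρ, |F z - F z'| ≤ (21 / 10 * K + m / 10) * ‖z - z'‖ := by
  intro z hz z' hz'
  refine (convex_ball p ρ).norm_image_sub_le_of_norm_fderiv_le (𝕜 := ℝ) hF (fun w hw => ?_) hz' hz
  refine (norm_fderiv_le F w).trans ?_
  have h1 := norm_le_norm_sub_add (dz F w) (h w)
  have h2 := hsim w hw
  have h3 := hK w hw
  have h4 := hm w hw
  linarith

theorem abs_le_supAbs {f : ℂ → ℝ} {s : Set ℂ} (hb : BddAbove ((fun z => |f z|) '' s)) {z : ℂ}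
    (hz : z ∈ s) : |f z| ≤ supAbs f s :=
  le_csSup hb ⟨z, hz, rfl⟩

theorem supAbs_le {f : ℂ → ℝ} {s : Set ℂ} {C : ℝ} (hs : s.Nonempty) (h : ∀ z ∈ s, |f z| ≤ C) :
    supAbs f s ≤ C :=
  csSup_le (hs.image _) (by rintro _ ⟨z, hz, rfl⟩; exact h z hz)

theorem bddAbove_abs_image_ball {F : ℂ → ℝ} {p : ℂ} {ρ : ℝ} (hF : ContinuousOn F (closedBall p ρ)) :
    BddAbove ((fun z => |F z|) '' ball p ρ) :=
  ((isCompact_closedBall p ρ).bddAbove_image hF.abs).mono (image_mono ball_subset_closedBall)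

/-- Unique continuation: if `F` vanishes near the origin, so does `h`, hence `h = 0` and `|F_z| ≤
|F| / 20`, which forces `F = 0` on a disk of radius less than `3`. -/
theorem exists_ne_zero_of_similarity {F : ℂ → ℝ} {h : ℂ → ℂ} {r : ℝ} (hr : 1 / 4 ≤ r) (hr3 : r < 3)
    (hF : ContDiffOn ℝ 2 F (ball 0 3)) (hh : DifferentiableOn ℂ h (ball 0 r))
    (hsim : ∀ z ∈ ball (0 : ℂ) r, ‖dz F z - h z‖ ≤ ‖h z‖ / 20 + |F z| / 20)
    (hne : ∃ z ∈ ball (0 : ℂ) r, F z ≠ 0) : ∃ z ∈ ball (0 : ℂ) (1 / 4), F z ≠ 0 := by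
  by_contra hcon
  push Not at hcon
  have h0m : (0 : ℂ) ∈ ball (0 : ℂ) r := by simp; linarith
  have hh0 : ∀ z ∈ ball (0 : ℂ) (1 / 4), h z = 0 := by
    intro z hz
    have h1 : F =ᶠ[𝓝 z] fun _ => 0 := by
      filter_upwards [isOpen_ball.mem_nhds hz] with w hw using hcon w hw
    have h2 : dz F z = 0 := by simp [dz, h1.fderiv_eq]
    have h3 := hsim z (ball_subset_ball hr hz)
    rw [h2, zero_sub, norm_neg, hcon z hz, abs_zero] at h3
    have := norm_nonneg (h z)
    rw [← norm_eq_zero]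
    linarith
  have hhz : EqOn h 0 (ball 0 r) := by
    refine (hh.analyticOnNhd isOpen_ball).eqOn_zero_of_preconnected_of_eventuallyEq_zero
      (convex_ball _ _).isPreconnected h0m ?_
    filter_upwards [isOpen_ball.mem_nhds (mem_ball_self (by norm_num : (0 : ℝ) < 1 / 4))] with w hw
      using hh0 w hw
  have hb := bddAbove_abs_image_ball (hF.continuousOn.mono (closedBall_subset_ball hr3))
  set m := supAbs F (ball 0 r) with hm
  have hm0 : 0 ≤ m := (abs_nonneg _).trans (abs_le_supAbs hb h0m)
  have hosc := abs_sub_le_of_similarity (K := 0) (m := m)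
    (fun z hz => (hF.contDiffAt (isOpen_ball.mem_nhds
        (ball_subset_ball hr3.le hz))).differentiableAt
      two_ne_zero) hsim
    (fun z hz => by rw [hhz hz]; simp) (fun z hz => abs_le_supAbs hb hz)
  have hm1 : m ≤ m / 10 * 3 := by
    refine supAbs_le ⟨0, h0m⟩ fun z hz => ?_
    have h1 := hosc z hz 0 h0m
    rw [hcon 0 (by simp), sub_zero, sub_zero] at h1
    have h2 : ‖z‖ ≤ 3 := by have : ‖z‖ < r := by simpa using hz
                            linarith
    calc |F z| ≤ (21 / 10 * 0 + m / 10) * ‖z‖ := h1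
      _ ≤ m / 10 * 3 := by rw [mul_zero, zero_add]; gcongr
  have hm2 : m = 0 := by linarith
  obtain ⟨z, hz, hFz⟩ := hne
  have := abs_le_supAbs hb hz
  rw [← hm, hm2] at this
  exact hFz (abs_eq_zero.1 (le_antisymm this (abs_nonneg _)))

theorem annulus_subset_ball (w : ℂ) (s t : ℝ) : annulus w s t ⊆ ball w t := fun _ hz => hz.2

/-- The largest disk centred on the middle circle of the annulus `A'` has radius `5/6 a δ`. -/
theorem ball_subset_annulusPrime {a δ κ : ℝ} (w : ℂ) (ha : 0 < a) (ha' : a < 1 / 3) (hδ : 0 < δ)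
    (hκ : κ ≤ 5 / 6 * a) :
    ball (w + ((1 - 13 / 6 * a) * δ : ℝ)) (κ * δ) ⊆ annulusPrime a δ w := by
  intro z hz
  have h1 : ‖z - (w + ((1 - 13 / 6 * a) * δ : ℝ))‖ < κ * δ := by simpa [dist_eq_norm] using hz
  have h2 : ‖(((1 - 13 / 6 * a) * δ : ℝ) : ℂ)‖ = (1 - 13 / 6 * a) * δ := by
    rw [norm_real, Real.norm_of_nonneg]
    exact mul_nonneg (by linarith) hδ.le
  have h3 : κ * δ ≤ 5 / 6 * a * δ := by gcongr
  have e : z - w = (z - (w + ((1 - 13 / 6 * a) * δ : ℝ))) + ((1 - 13 / 6 * a) * δ : ℝ) := by ring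
  have h4 := norm_add_le (z - (w + ((1 - 13 / 6 * a) * δ : ℝ))) (((1 - 13 / 6 * a) * δ : ℝ) : ℂ)
  have h5 := norm_sub_le (z - w) (z - (w + ((1 - 13 / 6 * a) * δ : ℝ)))
  rw [show z - w - (z - (w + ((1 - 13 / 6 * a) * δ : ℝ))) = (((1 - 13 / 6 * a) * δ : ℝ) : ℂ)
      by ring] at h5
  rw [← e] at h4
  rw [h2] at h4 h5
  refine ⟨?_, ?_⟩ <;> rw [dist_eq_norm] <;> nlinarith

theorem setIntegral_annulusSecond_le {F : ℂ → ℝ} {a δ m : ℝ} {w : ℂ} (ha : 0 < a) (hδ : 0 < δ)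
    (hm : ∀ z ∈ ball w δ, |F z| ≤ m) :
    ∫ z in annulusSecond a δ w, F z ^ 2 ≤ Real.pi * δ ^ 2 * m ^ 2 := by
  have hsub : annulusSecond a δ w ⊆ ball w δ :=
    (annulus_subset_ball _ _ _).trans (ball_subset_ball (by nlinarith))
  have hv : volume.real (ball w δ) = Real.pi * δ ^ 2 := by
    simp [Measure.real, ENNReal.toReal_ofReal hδ.le]; ring
  have h1 : ‖∫ z in annulusSecond a δ w, F z ^ 2‖ ≤ m ^ 2 * volume.real (annulusSecond a δ w) := by
    refine norm_setIntegral_le_of_norm_le_const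
      ((measure_mono hsub).trans_lt measure_ball_lt_top) fun z hz => ?_
    rw [norm_pow, Real.norm_eq_abs]
    gcongr
    exact hm z (hsub hz)
  have h2 : volume.real (annulusSecond a δ w) ≤ Real.pi * δ ^ 2 := by
    rw [← hv]; exact measureReal_mono hsub measure_ball_lt_top.ne
  calc _ ≤ _ := le_abs_self _
    _ ≤ m ^ 2 * (Real.pi * δ ^ 2) := h1.trans (by gcongr)
    _ = _ := by ring

theorem setIntegral_ball_le_annulusPrime {F : ℂ → ℝ} {a δ κ : ℝ} {w : ℂ} (ha : 0 < a)
    (ha' : a < 1 / 3)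
    (hδ : 0 < δ) (hκ : κ ≤ 5 / 6 * a) (hF : ContinuousOn F (closedBall w δ)) :
    ∫ z in ball (w + ((1 - 13 / 6 * a) * δ : ℝ)) (κ * δ), F z ^ 2 ≤
      ∫ z in annulusPrime a δ w, F z ^ 2 := by
  have hsub : annulusPrime a δ w ⊆ closedBall w δ :=
    (annulus_subset_ball _ _ _).trans ((ball_subset_ball (by nlinarith)).trans
        ball_subset_closedBall)
  refine setIntegral_mono_set ?_ (ae_of_all _ fun z => sq_nonneg _)
    (LE.le.eventuallyLE (ball_subset_annulusPrime w ha ha' hδ hκ))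
  exact ((hF.pow 2).integrableOn_compact (isCompact_closedBall w δ)).mono_set hsub

theorem not_isRapid_of_le_abs {F : ℂ → ℝ} {a δ κ m M : ℝ} {w : ℂ} (ha : 0 < a) (ha' : a < 1 / 3)
    (hδ : 0 < δ) (hκ0 : 0 < κ) (hκ : κ ≤ 5 / 6 * a) (hm : 0 < m)
        (hF : ContinuousOn F (closedBall w δ))
    (hlow : ∀ z ∈ ball w δ, m / 2 ≤ |F z|) (hup : ∀ z ∈ ball w δ, |F z| ≤ m) (hM : 8 / κ ^ 2 < M) :
    ¬ IsRapid a M F δ w := by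
  intro hr
  have h1 := setIntegral_annulusSecond_le (a := a) ha hδ hup
  have h2 := setIntegral_ball_le_annulusPrime ha ha' hδ hκ hF
  have hsub : ball (w + ((1 - 13 / 6 * a) * δ : ℝ)) (κ * δ) ⊆ ball w δ :=
    (ball_subset_annulusPrime w ha ha' hδ hκ).trans
      ((annulus_subset_ball _ _ _).trans (ball_subset_ball (by nlinarith)))
  have hv : volume.real (ball (w + ((1 - 13 / 6 * a) * δ : ℝ)) (κ * δ)) = Real.pi * (κ * δ) ^ 2 :=
      by
    simp [Measure.real, ENNReal.toReal_ofReal (mul_pos hκ0 hδ).le]; ring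
  have h3 : Real.pi * (κ * δ) ^ 2 * (m / 2) ^ 2 ≤
      ∫ z in ball (w + ((1 - 13 / 6 * a) * δ : ℝ)) (κ * δ), F z ^ 2 := by
    rw [← hv, ← smul_eq_mul, ← setIntegral_const]
    refine setIntegral_mono_on (integrableOn_const measure_ball_lt_top.ne) ?_ measurableSet_ball ?_
    · exact ((hF.pow 2).integrableOn_compact (isCompact_closedBall w δ)).mono_set
        (hsub.trans ball_subset_closedBall)
    · intro z hz
      have := hlow z (hsub hz)
      rw [← sq_abs (F z)]
      gcongr
  have hM0 : 0 < M := lt_trans (by positivity) hM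
  have h4 : M * (Real.pi * (κ * δ) ^ 2 * (m / 2) ^ 2) ≤ Real.pi * δ ^ 2 * m ^ 2 :=
    le_trans (by gcongr; exact h3.trans h2) (hr.trans h1)
  have h5 : M * κ ^ 2 / 4 * (Real.pi * δ ^ 2 * m ^ 2) ≤ 1 * (Real.pi * δ ^ 2 * m ^ 2) := by
    calc _ = M * (Real.pi * (κ * δ) ^ 2 * (m / 2) ^ 2) := by ring
      _ ≤ _ := by linarith
  have h6 := le_of_mul_le_mul_right h5 (by positivity)
  rw [div_lt_iff₀ (by positivity)] at hM
  linarith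

/-- If `h` has bounded relative variation on the disk, then both the oscillation of `F` over the
disk and, from below, the mean square of `F` over a small disk inside `A'` are governed by the same
number `|h p|`, so that `F` cannot grow rapidly. -/
theorem not_isRapid_of_slowly_varying {F : ℂ → ℝ} {h : ℂ → ℂ} {a δ κ Λ M : ℝ} {w : ℂ}
    (ha : 0 < a) (ha' : a < 1 / 3) (hδ : 0 < δ) (hδ1 : δ < 1 / 60) (hκ0 : 0 < κ)
        (hκ : κ ≤ 5 / 6 * a)
    (hΛ : 0 < Λ) (hΛκ : Λ * κ ≤ 1 / 2) (hF : ContDiffOn ℝ 2 F (ball w (2 * δ)))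
    (hh : DifferentiableOn ℂ h (ball w δ))
    (hsim : ∀ z ∈ ball w δ, ‖dz F z - h z‖ ≤ ‖h z‖ / 20 + |F z| / 20)
    (hslow : ∀ z ∈ ball w δ, ∀ z' ∈ ball w δ, h z' ≠ 0 ∧
      ‖h z - h z'‖ ≤ (Real.exp (Λ / δ * ‖z - z'‖) - 1) * ‖h z'‖)
    (hM : 8 / κ ^ 2 + 140000 * Real.exp (4 * Λ) / κ ^ 4 < M) :
    ¬ IsRapid a M F δ w := by
  intro hr
  set p : ℂ := w + ((1 - 13 / 6 * a) * δ : ℝ) with hp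
  set ρ := κ * δ with hρ
  have hρ0 : 0 < ρ := mul_pos hκ0 hδ
  have hFc : ContinuousOn F (closedBall w δ) :=
    hF.continuousOn.mono (closedBall_subset_ball (by linarith))
  have hsub : ball p ρ ⊆ ball w δ :=
    (ball_subset_annulusPrime w ha ha' hδ hκ).trans
      ((annulus_subset_ball _ _ _).trans (ball_subset_ball (by nlinarith)))
  -- The annulus `A'` ends at radius `(1 - 4/3 a) δ`, so there is room for the larger disk on which
  -- `h` has to be holomorphic.
  have hsub' : ball p (ρ + a * δ) ⊆ ball w δ := by
    intro z hz
    have h1 : ‖z - p‖ < ρ + a * δ := by simpa [dist_eq_norm] using hz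
    have h2 : ‖p - w‖ = (1 - 13 / 6 * a) * δ := by
      rw [hp, add_sub_cancel_left, norm_real, Real.norm_of_nonneg]
      exact mul_nonneg (by linarith) hδ.le
    have h3 := norm_sub_le_norm_sub_add_norm_sub z p w
    rw [mem_ball, dist_eq_norm]
    have h4 : κ * δ ≤ 5 / 6 * a * δ := by gcongr
    nlinarith
  have hρR : ρ < ρ + a * δ := by nlinarith
  have hpm : p ∈ ball w δ := hsub (mem_ball_self hρ0)
  have hFd : ContDiffOn ℝ 2 F (ball w δ) := hF.mono (ball_subset_ball (by linarith))
  set K := ‖h p‖ with hK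
  have hK0 : 0 < K := norm_pos_iff.2 (hslow p hpm p hpm).1
  have hκ1 : κ ≤ 1 := by linarith
  have hX : ∀ z ∈ ball p ρ, ‖h z‖ ≤ 2 * K := by
    intro z hz
    have h1 : ‖z - p‖ ≤ ρ := by simpa [dist_eq_norm] using (ball_subset_closedBall hz)
    have h2 := (hslow z (hsub hz) p hpm).2
    have h3 : Λ / δ * ‖z - p‖ ≤ 1 / 2 := by
      calc _ ≤ Λ / δ * (κ * δ) := by gcongr
        _ = Λ * κ := by field_simp
        _ ≤ _ := hΛκ
    have h4 : Real.exp (Λ / δ * ‖z - p‖) ≤ 2 := by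
      rw [← Real.le_log_iff_exp_le two_pos]
      linarith [Real.log_two_gt_d9]
    have h5 := norm_le_norm_sub_add (h z) (h p)
    nlinarith
  have h1 := sq_norm_mul_le_integral_sq hρ0 (by rw [hρ]; nlinarith) hρR (hFd.mono hsub')
      (hh.mono hsub')
    (fun z hz => hsim z (hsub' hz)) hX
  set J := ∫ z in ball p ρ, F z ^ 2 with hJ
  have hJ0 : 0 < J := by
    have : 0 < ‖h p‖ ^ 2 * ρ ^ 4 := by positivity
    linarith
  have hK2 : ∀ z ∈ ball w δ, ‖h z‖ ≤ Real.exp (2 * Λ) * K := by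
    intro z hz
    have h2 := (hslow z hz p hpm).2
    have h3 : ‖z - p‖ ≤ 2 * δ := by
      rw [mem_ball, dist_eq_norm] at hz hpm
      have := norm_sub_le_norm_sub_add_norm_sub z w p
      rw [norm_sub_rev w p] at this
      linarith
    have h4 : Λ / δ * ‖z - p‖ ≤ 2 * Λ := by
      calc _ ≤ Λ / δ * (2 * δ) := by gcongr
        _ = 2 * Λ := by field_simp
    have h4' := Real.exp_le_exp.2 h4
    have h5 := norm_le_norm_sub_add (h z) (h p)
    nlinarith
  have hb := bddAbove_abs_image_ball hFc
  set m := supAbs F (ball w δ) with hm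
  have hup : ∀ z ∈ ball w δ, |F z| ≤ m := fun z hz => abs_le_supAbs hb hz
  have hm0 : 0 ≤ m := (abs_nonneg _).trans (hup p hpm)
  set L := Real.exp (2 * Λ) * K with hL
  have hL0 : 0 < L := by positivity
  have hosc := abs_sub_le_of_similarity
    (fun z hz => (hFd.contDiffAt (isOpen_ball.mem_nhds hz)).differentiableAt two_ne_zero)
        hsim hK2 hup
  have hmF : ∀ z' ∈ ball w δ, m ^ 2 ≤ 8 * F z' ^ 2 + 162 * δ ^ 2 * L ^ 2 := by
    intro z' hz'
    have h2 : m ≤ |F z'| + (21 / 10 * L + m / 10) * (2 * δ) := by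
      refine supAbs_le ⟨p, hpm⟩ fun z hz => ?_
      have h3 := hosc z hz z' hz'
      have h4 : ‖z - z'‖ ≤ 2 * δ := by
        rw [mem_ball, dist_eq_norm] at hz hz'
        have := norm_sub_le_norm_sub_add_norm_sub z w z'
        rw [norm_sub_rev w z'] at this
        linarith
      have h5 := abs_sub_abs_le_abs_sub (F z) (F z')
      have h6 : (21 / 10 * L + m / 10) * ‖z - z'‖ ≤ (21 / 10 * L + m / 10) * (2 * δ) := by gcongr
      linarith
    have h3 : m ≤ 2 * |F z'| + 9 * δ * L := by nlinarith [abs_nonneg (F z'), mul_pos hδ hL0]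
    have h4 : m ^ 2 ≤ (2 * |F z'| + 9 * δ * L) ^ 2 := by gcongr
    rw [← sq_abs (F z')]
    nlinarith [sq_nonneg (2 * |F z'| - 9 * δ * L)]
  have hv : volume.real (ball p ρ) = Real.pi * ρ ^ 2 := by
    simp [Measure.real, ENNReal.toReal_ofReal hρ0.le]; ring
  have hF2 : IntegrableOn (fun z => F z ^ 2) (ball p ρ) :=
    ((hFc.pow 2).integrableOn_compact (isCompact_closedBall w δ)).mono_set
      (hsub.trans ball_subset_closedBall)
  -- Average the preceding bound over `z'` in the small disk.
  have h2 : Real.pi * ρ ^ 2 * m ^ 2 ≤ 8 * J + Real.pi * ρ ^ 2 * (162 * δ ^ 2 * L ^ 2) := by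
    have h3 : ∫ z in ball p ρ, m ^ 2 ≤ ∫ z in ball p ρ, (8 * F z ^ 2 + 162 * δ ^ 2 * L ^ 2) :=
      setIntegral_mono_on (integrableOn_const measure_ball_lt_top.ne)
        ((hF2.const_mul 8).add (integrableOn_const measure_ball_lt_top.ne)) measurableSet_ball
        fun z hz => hmF z (hsub hz)
    rw [integral_add (hF2.const_mul 8) (integrableOn_const measure_ball_lt_top.ne),
        integral_const_mul,
      setIntegral_const, setIntegral_const, hv, smul_eq_mul, smul_eq_mul] at h3
    exact h3
  have h3 : Real.pi * δ ^ 2 * m ^ 2 ≤ (8 / κ ^ 2 + 140000 * Real.exp (4 * Λ) / κ ^ 4) * J := by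
    have e4 : Real.exp (4 * Λ) = Real.exp (2 * Λ) ^ 2 := by
      rw [← Real.exp_nat_mul]; congr 1; push_cast; ring
    have hL2 : L ^ 2 * ρ ^ 4 ≤ Real.exp (4 * Λ) * (260 * J) := by
      rw [e4, hL, mul_pow, mul_assoc]
      gcongr
    have h5 : Real.pi * 162 * 260 ≤ 140000 := by linarith [Real.pi_lt_d2]
    have h6 : (Real.pi * δ ^ 2 * m ^ 2) * κ ^ 4 ≤
        (8 / κ ^ 2 + 140000 * Real.exp (4 * Λ) / κ ^ 4) * J * κ ^ 4 := by
      calc (Real.pi * δ ^ 2 * m ^ 2) * κ ^ 4 = κ ^ 2 * (Real.pi * ρ ^ 2 * m ^ 2) := by rw [hρ]; ring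
        _ ≤ κ ^ 2 * (8 * J + Real.pi * ρ ^ 2 * (162 * δ ^ 2 * L ^ 2)) := by gcongr
        _ = 8 * κ ^ 2 * J + Real.pi * 162 * (L ^ 2 * ρ ^ 4) := by rw [hρ]; ring
        _ ≤ 8 * κ ^ 2 * J + Real.pi * 162 * (Real.exp (4 * Λ) * (260 * J)) := by gcongr
        _ = 8 * κ ^ 2 * J + (Real.pi * 162 * 260) * (Real.exp (4 * Λ) * J) := by ring
        _ ≤ 8 * κ ^ 2 * J + 140000 * (Real.exp (4 * Λ) * J) := by gcongr
        _ = _ := by field_simp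
    exact le_of_mul_le_mul_right h6 (by positivity)
  have h4 := setIntegral_annulusSecond_le (a := a) ha hδ hup
  have h5 : J ≤ ∫ z in annulusPrime a δ w, F z ^ 2 :=
      setIntegral_ball_le_annulusPrime ha ha' hδ hκ hFc
  have hM0 : 0 < M := lt_trans (by positivity) hM
  have h6 : M * J ≤ M * ∫ z in annulusPrime a δ w, F z ^ 2 := by gcongr
  have h7 : M * J ≤ (8 / κ ^ 2 + 140000 * Real.exp (4 * Λ) / κ ^ 4) * J :=
    h6.trans (hr.trans (h4.trans h3))
  have := le_of_mul_le_mul_right h7 hJ0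
  linarith

/-! ### Counting the disks of rapid growth -/

theorem IsSeparated.two_sqrt_le_dist {δ : ℝ} {S : Finset ℂ} (hδ : 0 < δ)
    (h : IsSeparated (δ ^ (-(1 / 2) : ℝ)) δ S) :
    ∀ w ∈ S, ∀ w' ∈ S, w ≠ w' → 2 * √δ ≤ dist w w' := by
  intro w hw w' hw' hne
  have h1 := h w hw w' hw' hne
  have h2 : δ ^ (-(1 / 2) : ℝ) * δ = √δ := by
    rw [Real.sqrt_eq_rpow]
    nth_rewrite 2 [← Real.rpow_one δ]
    rw [← Real.rpow_add hδ]
    norm_num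
  rwa [mul_assoc, h2] at h1

end NodalGrowth

open NodalGrowth in
theorem proposition4p2p1 (a : ℝ) (ha_pos : 0 < a) (ha_small : a < 1 / 3) :
    ∃ c₅ ε₀ M₀ : ℝ, 0 < c₅ ∧ 0 < ε₀ ∧ 0 < M₀ ∧
      ∀ q F : ℂ → ℝ,
        ContDiffOn ℝ ∞ q (ball 0 3) →
        BddAbove ((fun z => |q z|) '' ball (0 : ℂ) 3) →
        NodalGrowth.supAbs q (ball 0 3) < ε₀ →
        NodalGrowth.IsSchrodingerSolution q F →
        (∃ z ∈ ball (0 : ℂ) 3, F z ≠ 0) →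
        ∀ (δ : ℝ) (S : Finset ℂ),
          0 < δ →
          δ < 1 / 60 →
          δ * NodalGrowth.betaStar F < 1 / 2 →
          (∀ w ∈ S, ball w δ ⊆ ball (0 : ℂ) (1 / 60)) →
          NodalGrowth.IsSeparated (δ ^ (-(1 / 2) : ℝ)) δ S →
          ∀ M : ℝ, M₀ < M →
            (({w : ℂ | w ∈ S ∧ NodalGrowth.IsRapid a M F δ w}.ncard : ℕ) : ℝ)
              ≤ c₅ * NodalGrowth.betaStar F := by
  -- The small disk inside `A'` has radius `κ δ`; `κ` is chosen with `κ ≤ 5/6 a` and `82 κ ≤ 1/2`,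
  -- where `82 / δ` bounds the logarithmic derivative of the holomorphic factor in a good disk.
  set κ : ℝ := a / 1000 with hκ
  have hκ0 : 0 < κ := by positivity
  have hκa : κ ≤ 5 / 6 * a := by rw [hκ]; linarith
  have hpos : 0 < 140000 * Real.exp (4 * 82) / κ ^ 4 := by positivity
  refine ⟨350, 1 / 10000, 8 / κ ^ 2 + 140000 * Real.exp (4 * 82) / κ ^ 4, by norm_num, by norm_num,
    by positivity, ?_⟩
  intro q F hq hqb hqε hF hne δ S hδ hδ1 hδβ hS hsep M hM
  obtain ⟨z₁, hz₁, hFz₁⟩ := hne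
  have hz₁' : ‖z₁‖ < 3 := by simpa using hz₁
  -- The radius has to exceed `|z₁|` for unique continuation and `5/2` for the interior estimate.
  obtain ⟨r, hr, hr3⟩ := exists_between (max_lt hz₁' (show (11 / 4 : ℝ) < 3 by norm_num))
  have hr1 : ‖z₁‖ < r := (le_max_left _ _).trans_lt hr
  have hr2 : 11 / 4 < r := (le_max_right _ _).trans_lt hr
  have hr3s : ball (0 : ℂ) r ⊆ ball 0 3 := ball_subset_ball hr3.le
  obtain ⟨h, hh, hsim⟩ := hF.exists_similarity (hq.of_le (by norm_num))
    (fun z hz => (abs_le_supAbs hqb hz).trans hqε.le) (by linarith : 0 < r) hr3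
  obtain ⟨z₂, hz₂, hFz₂⟩ := exists_ne_zero_of_similarity (by linarith) hr3 hF.contDiffOn hh hsim
    ⟨z₁, by simpa using hr1, hFz₁⟩
  have hcont : ∀ ρ < 3, ContinuousOn F (closedBall 0 ρ) := fun ρ hρ =>
    hF.contDiffOn.continuousOn.mono (closedBall_subset_ball hρ)
  have hbm := bddAbove_abs_image_ball (hcont (1 / 4) (by norm_num))
  have hbA := bddAbove_abs_image_ball (hcont (5 / 2) (by norm_num))
  set m := supAbs F (ball 0 (1 / 4)) with hm
  set A := supAbs F (ball 0 (5 / 2)) with hA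
  have hm0 : 0 < m := (abs_pos.2 hFz₂).trans_le (abs_le_supAbs hbm hz₂)
  have hmA : m ≤ A := supAbs_le ⟨z₂, hz₂⟩ fun z hz =>
    abs_le_supAbs hbA (ball_subset_ball (by norm_num) hz)
  have hA0 : 0 < A := hm0.trans_le hmA
  have hβ : growthExponent F ≤ betaStar F := le_max_left _ _
  have hβ1 : 1 ≤ betaStar F := le_max_right _ _
  have hgrow : growthExponent F = Real.log (A / m) := rfl
  have hFd : ∀ w ∈ S, ContDiffOn ℝ 2 F (ball w (2 * δ)) := by
    intro w hw
    refine hF.contDiffOn.mono fun z hz => ?_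
    have h1 : ‖w‖ < 1 / 60 := by simpa using hS w hw (mem_ball_self hδ)
    have h2 : ‖z - w‖ < 2 * δ := by simpa [dist_eq_norm] using hz
    have h3 := norm_le_norm_sub_add z w
    simp; linarith
  have hS4 : ∀ w ∈ S, ball w δ ⊆ ball 0 (1 / 4) := fun w hw =>
    (hS w hw).trans (ball_subset_ball (by norm_num))
  have hSr : ∀ w ∈ S, ball w δ ⊆ ball 0 r := fun w hw =>
    (hS4 w hw).trans (ball_subset_ball (by linarith))
  by_cases hsmall : ∀ z ∈ ball (0 : ℂ) (1 / 4), ‖h z‖ ≤ m / 20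
  · -- `F` is nearly constant on `1/4 𝔻`, so no disk is of rapid growth.
    have hlow : ∀ z ∈ ball (0 : ℂ) (1 / 4), m / 2 ≤ |F z| := by
      intro z hz
      have hosc := abs_sub_le_of_similarity (m := m)
        (fun z hz => (hF.contDiffOn.contDiffAt (isOpen_ball.mem_nhds
          (ball_subset_ball (by norm_num) hz))).differentiableAt two_ne_zero)
        (fun z hz => hsim z (ball_subset_ball (by linarith) hz)) hsmall
        (fun z hz => abs_le_supAbs hbm hz)
      have h1 : m ≤ |F z| + (21 / 10 * (m / 20) + m / 10) * (1 / 2) := by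
        refine supAbs_le ⟨z, hz⟩ fun z' hz' => ?_
        have h2 := hosc z' hz' z hz
        have h3 : ‖z' - z‖ ≤ 1 / 2 := by
          have h4 : ‖z‖ < 1 / 4 := by simpa using hz
          have h5 : ‖z'‖ < 1 / 4 := by simpa using hz'
          linarith [norm_sub_le z' z]
        have h5 := abs_sub_abs_le_abs_sub (F z') (F z)
        have h6 : (21 / 10 * (m / 20) + m / 10) * ‖z' - z‖ ≤
            (21 / 10 * (m / 20) + m / 10) * (1 / 2) := by gcongr
        linarith
      linarith
    have hempty : {w : ℂ | w ∈ S ∧ IsRapid a M F δ w} = ∅ := by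
      refine eq_empty_of_forall_notMem fun w hw => ?_
      refine not_isRapid_of_le_abs ha_pos ha_small hδ hκ0 hκa hm0
        ((hFd w hw.1).continuousOn.mono (closedBall_subset_ball (by linarith)))
        (fun z hz => hlow z (hS4 w hw.1 hz))
        (fun z hz => abs_le_supAbs hbm (hS4 w hw.1 hz)) (by linarith) hw.2
    rw [hempty, ncard_empty, Nat.cast_zero]
    positivity
  · push Not at hsmall
    obtain ⟨z₀, hz₀, hμ⟩ := hsmall
    have hz₀' : ‖z₀‖ ≤ 1 / 4 := by simpa using (ball_subset_closedBall hz₀)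
    have hB := norm_le_of_abs_le (by linarith) (hF.contDiffOn.mono hr3s) hh hsim
      (A := A) (fun z hz => abs_le_supAbs hbA hz)
    obtain ⟨E, -, hEc, hEslow⟩ := exists_finset_slowly_varying hz₀' (by positivity : 0 < m / 20)
      (hh.mono (ball_subset_ball (by linarith))) hB hμ.le hδ hδ1 S hS (hsep.two_sqrt_le_dist hδ)
    set N := Real.log (80 * A / (m / 20)) with hN
    have hNβ : N ≤ 8 + betaStar F := by
      have e : 80 * A / (m / 20) = 1600 * (A / m) := by field_simp; norm_num
      have h1 : Real.log 1600 ≤ 8 := by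
        rw [Real.log_le_iff_le_exp (by norm_num)]
        have h2 : Real.exp 8 = Real.exp 1 ^ 8 := by rw [← Real.exp_nat_mul]; norm_num
        have h3 : (2.7 : ℝ) ≤ Real.exp 1 := by linarith [Real.exp_one_gt_d9]
        rw [h2]
        calc (1600 : ℝ) ≤ 2.7 ^ 8 := by norm_num
          _ ≤ _ := by gcongr
      rw [hN, e, Real.log_mul (by norm_num) (by positivity), ← hgrow]
      linarith
    have hsub : {w : ℂ | w ∈ S ∧ IsRapid a M F δ w} ⊆ (E : Set ℂ) := by
      rintro w ⟨hw, hrap⟩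
      by_contra hwE
      refine not_isRapid_of_slowly_varying (Λ := 82) ha_pos ha_small hδ hδ1 hκ0 hκa (by norm_num)
        (by rw [hκ]; linarith) (hFd w hw) (hh.mono (hSr w hw)) (fun z hz => hsim z (hSr w hw hz))
        (fun z hz z' hz' => ?_) hM hrap
      obtain ⟨h1, h2⟩ := hEslow w hw hwE z hz z' hz'
      refine ⟨h1, h2.trans ?_⟩
      -- This is where `δ β* < 1/2` enters: `δ (N + 1) ≤ 9/60 + 1/2 < 1`.
      have h3 : 80 * (N + 1) + 2 / δ ≤ 82 / δ := by
        rw [le_div_iff₀ hδ, add_mul, div_mul_cancel₀ _ hδ.ne']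
        nlinarith
      gcongr
    calc (({w : ℂ | w ∈ S ∧ IsRapid a M F δ w}.ncard : ℕ) : ℝ) ≤ E.card := by
          rw [← ncard_coe_finset E]
          exact_mod_cast ncard_le_ncard hsub E.finite_toSet
      _ ≤ 35 * (N + 1) := hEc
      _ ≤ 350 * betaStar F := by linarith
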